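/- Let $R$ be an associative ring with unity. Modules are left $R$-modules unless stated otherwise. A module is Gorenstein projective (class $\mathcal{GP}$) if it is a module of cycles of an exact complex $P=(\cdots\to P_1\to P_0\to P_{-1}\to\cdots)$ of projective modules such that $\operatorname{Hom}_R(P,Q)$ is exact for every projective module $Q$; it is projectively coresolved Gorenstein flat (class $\mathcal{PGF}$) if it is a module of cycles of an exact complex $P$ of projective modules such that $I\otimes_R P$ is exact for every injective right $R$-module $I$. Let $\mathrm{Flat}$ be the class of flat modules, and for a class $\mathcal{C}$ of modules let $\mathcal{C}^{\perp}$ be the class of all modules $X$ with $\operatorname{Ext}^1_R(C,X)=0$ for every $C\in\mathcal{C}$. Theorem 4. Let $R$ be right coherent, i.e. every finitely generated right ideal of $R$ is finitely presented. Then $\mathcal{GP}=\mathcal{PGF}$ if and only if $\mathrm{Flat}\subseteq\mathcal{GP}^{\perp}$. In particular, if moreover $R$ is left $n$-perfect for some integer $n\ge 0$, i.e. every flat module has projective dimension at most $n$, then both of these equivalent conditions hold: $\mathcal{GP}=\mathcal{PGF}$ and $\mathrm{Flat}\subseteq\mathcal{GP}^{\perp}$. -/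

import Mathlib

open CategoryTheory
open scoped TensorProduct

universe u

/-! `R` is an associative unital ring. Left modules are objects of `ModuleCat.{u} R`; right
`R`-modules are modules over `Rᵐᵒᵖ`, the right action `x · r` being `MulOpposite.op r • x`. -/

section TensorProduct

variable (R : Type u) [Ring R]

/-- The subgroup of `N ⊗[ℤ] M` generated by the elements `(x · r) ⊗ m - x ⊗ (r m)`. -/
def balancedRelations (N M : Type u) [AddCommGroup N] [Module Rᵐᵒᵖ N]
    [AddCommGroup M] [Module R M] : AddSubgroup (N ⊗[ℤ] M) :=
  AddSubgroup.closure {t | ∃ (x : N) (r : R) (m : M),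
    t = (MulOpposite.op r • x) ⊗ₜ[ℤ] m - x ⊗ₜ[ℤ] (r • m)}

/-- The tensor product `N ⊗_R M` of a right `R`-module `N` and a left `R`-module `M`, an abelian
group. -/
abbrev BalancedTensor (N M : Type u) [AddCommGroup N] [Module Rᵐᵒᵖ N]
    [AddCommGroup M] [Module R M] : Type u :=
  (N ⊗[ℤ] M) ⧸ balancedRelations R N M

variable {R}

/-- Additive maps commuting with the actions respect the balancing relations. -/
theorem balancedRelations_le_comap {N N' M M' : Type u}
    [AddCommGroup N] [Module Rᵐᵒᵖ N] [AddCommGroup N'] [Module Rᵐᵒᵖ N']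
    [AddCommGroup M] [Module R M] [AddCommGroup M'] [Module R M']
    (g : N →ₗ[Rᵐᵒᵖ] N') (f : M →ₗ[R] M') :
    balancedRelations R N M ≤ (balancedRelations R N' M').comap
      (TensorProduct.map g.toAddMonoidHom.toIntLinearMap
        f.toAddMonoidHom.toIntLinearMap).toAddMonoidHom := by
  refine (AddSubgroup.closure_le _).2 ?_
  rintro _ ⟨x, r, m, rfl⟩
  refine AddSubgroup.subset_closure ⟨g x, r, f m, ?_⟩
  simp

/-- The homomorphism `g ⊗ f : N ⊗_R M → N' ⊗_R M'` of abelian groups. -/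
def BalancedTensor.map {N N' M M' : Type u}
    [AddCommGroup N] [Module Rᵐᵒᵖ N] [AddCommGroup N'] [Module Rᵐᵒᵖ N']
    [AddCommGroup M] [Module R M] [AddCommGroup M'] [Module R M']
    (g : N →ₗ[Rᵐᵒᵖ] N') (f : M →ₗ[R] M') :
    BalancedTensor R N M →+ BalancedTensor R N' M' :=
  QuotientAddGroup.map _ _
    (TensorProduct.map g.toAddMonoidHom.toIntLinearMap
      f.toAddMonoidHom.toIntLinearMap).toAddMonoidHom
    (balancedRelations_le_comap g f)

end TensorProduct

section Classes

variable (R : Type u) [Ring R]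

/-- `R` is right coherent: every finitely generated right ideal is finitely presented. -/
def IsRightCoherent : Prop :=
  ∀ I : Submodule Rᵐᵒᵖ R, I.FG → Module.FinitePresentation Rᵐᵒᵖ I

/-- The class of flat left `R`-modules: `- ⊗_R M` preserves injectivity of maps of right
`R`-modules. -/
def flatModules : ObjectProperty (ModuleCat.{u} R) := fun M =>
  ∀ (N N' : Type u) [AddCommGroup N] [Module Rᵐᵒᵖ N] [AddCommGroup N'] [Module Rᵐᵒᵖ N']
    (g : N →ₗ[Rᵐᵒᵖ] N'), Function.Injective g →
      Function.Injective (BalancedTensor.map g (LinearMap.id : M →ₗ[R] M))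

/-- `R` is left `n`-perfect: every flat left `R`-module has projective dimension at most `n`. -/
def IsLeftPerfectOfDim (n : ℕ) : Prop :=
  ∀ F : ModuleCat.{u} R, flatModules R F → HasProjectiveDimensionLE F n

/-- Exact complexes `⋯ ⟶ X 1 ⟶ X 0 ⟶ X (-1) ⟶ ⋯` of projective left `R`-modules. -/
structure ExactProjectiveComplex where
  /-- the modules -/
  X : ℤ → ModuleCat.{u} R
  /-- the differentials -/
  d : ∀ i : ℤ, X (i + 1) →ₗ[R] X i
  projective : ∀ i, Module.Projective R (X i)
  exact : ∀ i, Function.Exact (d (i + 1)) (d i)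

variable {R}

/-- The complex `Hom_R(P, Q)` of abelian groups is exact. -/
def ExactProjectiveComplex.HomExact (P : ExactProjectiveComplex R) (Q : ModuleCat.{u} R) : Prop :=
  ∀ i : ℤ, Function.Exact
    (fun f : P.X i →ₗ[R] Q => f ∘ₗ P.d i)
    (fun f : P.X (i + 1) →ₗ[R] Q => f ∘ₗ P.d (i + 1))

/-- The complex `I ⊗_R P` of abelian groups is exact, for a right `R`-module `I`. -/
def ExactProjectiveComplex.TensorExact (P : ExactProjectiveComplex R)
    (I : Type u) [AddCommGroup I] [Module Rᵐᵒᵖ I] : Prop :=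
  ∀ i : ℤ, Function.Exact
    (BalancedTensor.map (LinearMap.id : I →ₗ[Rᵐᵒᵖ] I) (P.d (i + 1)))
    (BalancedTensor.map (LinearMap.id : I →ₗ[Rᵐᵒᵖ] I) (P.d i))

/-- `M` is (isomorphic to) a module of cycles of `P`. -/
def ExactProjectiveComplex.IsCycle (P : ExactProjectiveComplex R) (M : ModuleCat.{u} R) : Prop :=
  ∃ i : ℤ, Nonempty (M ≃ₗ[R] LinearMap.ker (P.d i))

variable (R)

/-- The class of Gorenstein projective left `R`-modules. -/
def gorensteinProjective : ObjectProperty (ModuleCat.{u} R) := fun M =>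
  ∃ P : ExactProjectiveComplex R,
    (∀ Q : ModuleCat.{u} R, Module.Projective R Q → P.HomExact Q) ∧ P.IsCycle M

/-- The class of projectively coresolved Gorenstein flat left `R`-modules. -/
def projectivelyCoresolvedGorensteinFlat : ObjectProperty (ModuleCat.{u} R) := fun M =>
  ∃ P : ExactProjectiveComplex R,
    (∀ (I : Type u) [AddCommGroup I] [Module Rᵐᵒᵖ I], Module.Injective Rᵐᵒᵖ I →
      P.TensorExact I) ∧ P.IsCycle M

variable {R}

/-- The right orthogonal class `C^⊥` of `C`: the modules `X` with `Ext¹_R(A, X) = 0` for every `A`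
in `C`. -/
def extRightOrthogonal (C : ObjectProperty (ModuleCat.{u} R)) : ObjectProperty (ModuleCat.{u} R) :=
  fun X => ∀ A : ModuleCat.{u} R, C A → Subsingleton (Abelian.Ext A X 1)

end Classes

/-! Write X⁺ for the character module Hom_ℤ(X, ℚ/ℤ). For a right module I, the complex I ⊗ P is
exact if and only if Hom(P, I⁺) is (`exact_tensor_iff`), and over a right coherent ring I⁺ is flat
when I is injective (`EquationallyFlat.of_isRightCoherent`). If flat modules lie in GP^⊥, then a
totally acyclic P, all of whose cycles are in GP, has Hom(P, I⁺) exact; this gives GP ≤ PGF.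

The rest of the equivalence depends on `homExact_of_tensorExact`: if I ⊗ P is exact for all
injective I, then Hom(P, F) is exact for every flat F. Taking F projective yields PGF ≤ GP; taking F
flat yields Flat ≤ PGF^⊥. For the proof, F embeds in F⁺⁺ with flat cokernel, so it has an infinite
coresolution with terms G n = (F n)⁺⁺ and flat cosyzygies F n, F 0 = F. A cocycle g : P → F extends
step by step to a chain map into the exact differential module F × ∏ G n, whose cycles ∏ F n are
flat by coherence. Such a map is null-homotopic, and the F-component of the homotopy exhibits g as a
coboundary.

The null-homotopy (`EquationallyFlat.exists_homotopy`) is proved without gradings, for modules over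
the dual numbers R[ε]. An exact differential module with flat cycles is flat over R[ε]. A chain map
to it from a differential module free on a countable set lifts to a free R[ε]-module, by way of a
telescope with a free resolution of length one, and free R[ε]-modules are contractible. Zorn's lemma
removes countability, and retracts give projective sources.

In the n-perfect case, dimension shifting extends exactness of Hom(P, -) from projective modules to
modules of finite projective dimension, hence to flat ones. -/

/-! ### Character modules and exactness of sequences of abelian groups -/

section Characters

variable {R : Type u} [Ring R]

/-- The character module of a left module is a right module. -/
instance CharacterModule.moduleOfLeft (X : Type u) [AddCommGroup X] [Module R X] :
    Module Rᵐᵒᵖ (CharacterModule X) where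
  smul r f := AddMonoidHom.comp f (DistribSMul.toAddMonoidHom X r.unop)
  one_smul f := CharacterModule.ext _ fun x => congrArg f (one_smul R x)
  mul_smul r s f := CharacterModule.ext _ fun x => congrArg f (mul_smul s.unop r.unop x)
  smul_zero _ := CharacterModule.ext _ fun _ => rfl
  smul_add _ _ _ := CharacterModule.ext _ fun _ => rfl
  add_smul r s f := CharacterModule.ext _ fun x =>
    (congrArg f (add_smul r.unop s.unop x)).trans (map_add f _ _)
  zero_smul f := CharacterModule.ext _ fun x => (congrArg f (zero_smul R x)).trans (map_zero f)

/-- The character module of a right module is a left module. -/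
instance CharacterModule.moduleOfRight (X : Type u) [AddCommGroup X] [Module Rᵐᵒᵖ X] :
    Module R (CharacterModule X) where
  smul r f := AddMonoidHom.comp f (DistribSMul.toAddMonoidHom X (MulOpposite.op r))
  one_smul f := CharacterModule.ext _ fun x => congrArg f (one_smul Rᵐᵒᵖ x)
  mul_smul r s f := CharacterModule.ext _ fun x =>
    congrArg f (mul_smul (MulOpposite.op s) (MulOpposite.op r) x)
  smul_zero _ := CharacterModule.ext _ fun _ => rfl
  smul_add _ _ _ := CharacterModule.ext _ fun _ => rfl
  add_smul r s f := CharacterModule.ext _ fun x =>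
    (congrArg f (add_smul (MulOpposite.op r) (MulOpposite.op s) x)).trans (map_add f _ _)
  zero_smul f := CharacterModule.ext _ fun x => (congrArg f (zero_smul Rᵐᵒᵖ x)).trans (map_zero f)

/-- Characters extend along injective homomorphisms of abelian groups. -/
theorem CharacterModule.exists_extension {A B : Type u} [AddCommGroup A] [AddCommGroup B]
    (f : A →+ B) (hf : Function.Injective f) (c : CharacterModule A) :
    ∃ c' : CharacterModule B, ∀ a, c' (f a) = c a := by
  obtain ⟨c', h⟩ := CharacterModule.dual_surjective_of_injective f.toIntLinearMap hf c
  exact ⟨c', fun a => DFunLike.congr_fun h a⟩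

theorem CharacterModule.exists_extension_of_ker_le {A B : Type u} [AddCommGroup A] [AddCommGroup B]
    (f : A →+ B) (c : CharacterModule A) (h : ∀ a, f a = 0 → c a = 0) :
    ∃ c' : CharacterModule B, ∀ a, c' (f a) = c a := by
  let fbar : A ⧸ f.ker →+ B := QuotientAddGroup.kerLift f
  obtain ⟨c', hc'⟩ := CharacterModule.exists_extension fbar (QuotientAddGroup.kerLift_injective f)
    (QuotientAddGroup.lift f.ker (c : A →+ AddCircle (1 : ℚ)) (fun a ha => h a ha))
  exact ⟨c', fun a => hc' (QuotientAddGroup.mk a)⟩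

/-- A subgroup is the intersection of the kernels of the characters that kill it. -/
theorem CharacterModule.mem_of_forall {A : Type u} [AddCommGroup A] (S : AddSubgroup A) (a : A)
    (h : ∀ c : CharacterModule A, (∀ s ∈ S, c s = 0) → c a = 0) : a ∈ S := by
  rw [← QuotientAddGroup.eq_zero_iff]
  refine CharacterModule.eq_zero_of_character_apply fun c => ?_
  refine h (AddMonoidHom.comp c (QuotientAddGroup.mk' S)) fun s hs => ?_
  change c (QuotientAddGroup.mk s) = 0
  rw [(QuotientAddGroup.eq_zero_iff s).2 hs, map_zero]

/-- `ℚ/ℤ` is an injective cogenerator of abelian groups. -/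
theorem CharacterModule.exact_iff {A B C : Type u} [AddCommGroup A] [AddCommGroup B]
    [AddCommGroup C] (f : A →+ B) (g : B →+ C) :
    Function.Exact f g ↔
      ∀ c : CharacterModule B,
        (∀ a, c (f a) = 0) ↔ ∃ c' : CharacterModule C, ∀ b, c' (g b) = c b := by
  constructor
  · intro h c
    constructor
    · intro hc
      refine CharacterModule.exists_extension_of_ker_le g c fun b hb => ?_
      obtain ⟨a, rfl⟩ := (h b).1 hb
      exact hc a
    · rintro ⟨c', hc'⟩ a
      rw [← hc', h.apply_apply_eq_zero, map_zero]
  · intro h b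
    constructor
    · intro hb
      refine CharacterModule.mem_of_forall f.range b fun c hc => ?_
      obtain ⟨c', hc'⟩ := (h c).1 fun a => hc _ ⟨a, rfl⟩
      rw [← hc', hb, map_zero]
    · rintro ⟨a, rfl⟩
      refine CharacterModule.eq_zero_of_character_apply fun c => ?_
      exact (h (AddMonoidHom.comp c g)).2 ⟨c, fun b => rfl⟩ a

end Characters

/-! ### Characters of the balanced tensor product -/

namespace BalancedTensor

variable {R : Type u} [Ring R] {N N' M M' : Type u}
  [AddCommGroup N] [Module Rᵐᵒᵖ N] [AddCommGroup N'] [Module Rᵐᵒᵖ N']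
  [AddCommGroup M] [Module R M] [AddCommGroup M'] [Module R M']

variable (R) in
/-- The pure tensor `x ⊗ m`. -/
def tmul (x : N) (m : M) : BalancedTensor R N M := QuotientAddGroup.mk (x ⊗ₜ[ℤ] m)

theorem map_tmul (g : N →ₗ[Rᵐᵒᵖ] N') (f : M →ₗ[R] M') (x : N) (m : M) :
    map g f (tmul R x m) = tmul R (g x) (f m) := rfl

theorem tmul_add (x : N) (m m' : M) : tmul R x (m + m') = tmul R x m + tmul R x m' :=
  congrArg QuotientAddGroup.mk (TensorProduct.tmul_add x m m')

theorem add_tmul (x x' : N) (m : M) : tmul R (x + x') m = tmul R x m + tmul R x' m :=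
  congrArg QuotientAddGroup.mk (TensorProduct.add_tmul x x' m)

theorem smul_tmul (x : N) (r : R) (m : M) : tmul R (MulOpposite.op r • x) m = tmul R x (r • m) := by
  rw [← sub_eq_zero]
  exact (QuotientAddGroup.eq_zero_iff _).2 (AddSubgroup.subset_closure ⟨x, r, m, rfl⟩)

theorem hom_ext {A : Type*} [AddCommGroup A] {c c' : BalancedTensor R N M →+ A}
    (h : ∀ x m, c (tmul R x m) = c' (tmul R x m)) : c = c' := by
  ext t
  induction t using TensorProduct.induction_on with
  | zero => exact (map_zero c).trans (map_zero c').symm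
  | tmul x m => exact h x m
  | add s t hs ht =>
    rw [map_add, map_add, hs, ht]

/-- The homomorphism out of `N ⊗_R M` given by a balanced biadditive map. -/
def lift {A : Type*} [AddCommGroup A] (f : N →+ M →+ A)
    (hf : ∀ (x : N) (r : R) (m : M), f (MulOpposite.op r • x) m = f x (r • m)) :
    BalancedTensor R N M →+ A :=
  QuotientAddGroup.lift _ (TensorProduct.liftAddHom f (fun r x m => by simp)) (by
    refine (AddSubgroup.closure_le _).2 ?_
    rintro _ ⟨x, r, m, rfl⟩
    change TensorProduct.liftAddHom f _ _ = 0
    rw [map_sub, TensorProduct.liftAddHom_tmul, TensorProduct.liftAddHom_tmul, hf, sub_self])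

/-- Right linear maps into a character module give characters of the tensor product. -/
theorem exists_character_of_right (g : N →ₗ[Rᵐᵒᵖ] CharacterModule M) :
    ∃ c : CharacterModule (BalancedTensor R N M), ∀ x m, c (tmul R x m) = g x m := by
  let f : N →+ M →+ AddCircle (1 : ℚ) :=
    { toFun := fun x => g x
      map_zero' := map_zero g
      map_add' := fun x y => map_add g x y }
  exact ⟨lift f fun x r m => DFunLike.congr_fun (map_smul g (MulOpposite.op r) x) m,
    fun x m => rfl⟩

theorem exists_right_of_character (c : CharacterModule (BalancedTensor R N M)) :
    ∃ g : N →ₗ[Rᵐᵒᵖ] CharacterModule M, ∀ x m, g x m = c (tmul R x m) :=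
  ⟨{ toFun := fun x => (AddMonoidHom.mk' (fun m => c (tmul R x m))
        fun m m' => by rw [tmul_add, map_add] : M →+ AddCircle (1 : ℚ))
     map_add' := fun x y => CharacterModule.ext _ fun m =>
        (congrArg c (add_tmul x y m)).trans (map_add c _ _)
     map_smul' := fun r x => CharacterModule.ext _ fun m => congrArg c (smul_tmul x r.unop m) },
   fun _ _ => rfl⟩

/-- Left linear maps into a character module give characters of the tensor product. -/
theorem exists_character_of_left (g : M →ₗ[R] CharacterModule N) :
    ∃ c : CharacterModule (BalancedTensor R N M), ∀ x m, c (tmul R x m) = g m x := by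
  let f : M →+ N →+ AddCircle (1 : ℚ) :=
    { toFun := fun x => g x
      map_zero' := map_zero g
      map_add' := fun x y => map_add g x y }
  exact ⟨lift f.flip fun x r m => (DFunLike.congr_fun (map_smul g r m) x).symm,
    fun x m => rfl⟩

theorem exists_left_of_character (c : CharacterModule (BalancedTensor R N M)) :
    ∃ g : M →ₗ[R] CharacterModule N, ∀ x m, g m x = c (tmul R x m) :=
  ⟨{ toFun := fun m => (AddMonoidHom.mk' (fun x => c (tmul R x m))
        fun x x' => by rw [add_tmul, map_add] : N →+ AddCircle (1 : ℚ))
     map_add' := fun m m' => CharacterModule.ext _ fun x =>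
        (congrArg c (tmul_add x m m')).trans (map_add c _ _)
     map_smul' := fun r m => CharacterModule.ext _ fun x => congrArg c (smul_tmul x r m).symm },
   fun _ _ => rfl⟩

theorem character_ext {c c' : CharacterModule (BalancedTensor R N M)}
    (h : ∀ x m, c (tmul R x m) = c' (tmul R x m)) : c = c' :=
  hom_ext (c := (c : BalancedTensor R N M →+ AddCircle (1 : ℚ))) h

end BalancedTensor

/-! ### Flatness and tensor exactness through character modules -/

section Flat

variable {R : Type u} [Ring R]

/-- A left module is flat if and only if its character module is injective. -/
theorem flatModules_iff_injective (F : ModuleCat.{u} R) :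
    flatModules R F ↔ Module.Injective Rᵐᵒᵖ (CharacterModule F) := by
  constructor
  · intro hF
    refine ⟨fun N N' _ _ _ _ i hi g => ?_⟩
    obtain ⟨c, hc⟩ := BalancedTensor.exists_character_of_right g
    obtain ⟨c', hc'⟩ := CharacterModule.exists_extension _ (hF N N' i hi) c
    obtain ⟨g', hg'⟩ := BalancedTensor.exists_right_of_character c'
    refine ⟨g', fun x => CharacterModule.ext _ fun m => ?_⟩
    rw [hg', ← hc, ← hc']
    rfl
  · intro hF N N' _ _ _ _ i hi
    refine (injective_iff_map_eq_zero _).2 fun t ht =>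
      CharacterModule.eq_zero_of_character_apply fun c => ?_
    obtain ⟨g, hg⟩ := BalancedTensor.exists_right_of_character c
    obtain ⟨g', hg'⟩ := hF.out i hi g
    obtain ⟨c', hc'⟩ := BalancedTensor.exists_character_of_right g'
    have : (AddMonoidHom.comp c' (BalancedTensor.map i LinearMap.id) :
        CharacterModule (BalancedTensor R N F)) = c := by
      refine BalancedTensor.character_ext fun x m => ?_
      change c' (BalancedTensor.map i LinearMap.id _) = _
      rw [BalancedTensor.map_tmul, hc', hg', hg]
      rfl
    rw [← this]
    change c' (BalancedTensor.map i LinearMap.id t) = 0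
    rw [ht, map_zero]

/-- `I ⊗_R -` is exact at a place if and only if `Hom_R(-, I⁺)` is. -/
theorem exact_tensor_iff {I A B C : Type u} [AddCommGroup I] [Module Rᵐᵒᵖ I]
    [AddCommGroup A] [Module R A] [AddCommGroup B] [Module R B] [AddCommGroup C] [Module R C]
    (f : A →ₗ[R] B) (g : B →ₗ[R] C) :
    Function.Exact (BalancedTensor.map (LinearMap.id : I →ₗ[Rᵐᵒᵖ] I) f)
        (BalancedTensor.map (LinearMap.id : I →ₗ[Rᵐᵒᵖ] I) g) ↔
      Function.Exact (fun h : C →ₗ[R] CharacterModule I => h ∘ₗ g)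
        (fun h : B →ₗ[R] CharacterModule I => h ∘ₗ f) := by
  rw [CharacterModule.exact_iff]
  have key : ∀ (c : CharacterModule (BalancedTensor R I B)) (h : B →ₗ[R] CharacterModule I),
      (∀ x m, h m x = c (BalancedTensor.tmul R x m)) →
      (((∀ a, c (BalancedTensor.map (LinearMap.id : I →ₗ[Rᵐᵒᵖ] I) f a) = 0) ↔ h ∘ₗ f = 0) ∧
      ((∃ c' : CharacterModule (BalancedTensor R I C),
        ∀ b, c' (BalancedTensor.map (LinearMap.id : I →ₗ[Rᵐᵒᵖ] I) g b) = c b) ↔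
        ∃ h' : C →ₗ[R] CharacterModule I, h' ∘ₗ g = h)) := by
    intro c h hc
    refine ⟨⟨fun H => ?_, fun H => ?_⟩, ⟨?_, ?_⟩⟩
    · refine LinearMap.ext fun a => CharacterModule.ext _ fun x => ?_
      exact (hc x (f a)).trans (H (BalancedTensor.tmul R x a))
    · have : (AddMonoidHom.comp c (BalancedTensor.map (LinearMap.id : I →ₗ[Rᵐᵒᵖ] I) f) :
          CharacterModule (BalancedTensor R I A)) = 0 := by
        refine BalancedTensor.character_ext fun x a => ?_
        exact (hc x (f a)).symm.trans (DFunLike.congr_fun (LinearMap.congr_fun H a) x)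
      exact fun a => DFunLike.congr_fun this a
    · rintro ⟨c', hc'⟩
      obtain ⟨h', hh'⟩ := BalancedTensor.exists_left_of_character c'
      refine ⟨h', LinearMap.ext fun b => CharacterModule.ext _ fun x => ?_⟩
      exact (hh' x (g b)).trans ((hc' (BalancedTensor.tmul R x b)).trans (hc x b).symm)
    · rintro ⟨h', rfl⟩
      obtain ⟨c', hc'⟩ := BalancedTensor.exists_character_of_left h'
      refine ⟨c', fun b => ?_⟩
      have : (AddMonoidHom.comp c' (BalancedTensor.map (LinearMap.id : I →ₗ[Rᵐᵒᵖ] I) g) :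
          CharacterModule (BalancedTensor R I B)) = c := by
        refine BalancedTensor.character_ext fun x a => ?_
        exact (hc' x (g a)).trans (hc x a)
      exact DFunLike.congr_fun this b
  constructor
  · intro H h
    obtain ⟨c, hc⟩ := BalancedTensor.exists_character_of_left h
    have := key c h fun x m => (hc x m).symm
    exact this.1.symm.trans ((H c).trans this.2)
  · intro H c
    obtain ⟨h, hh⟩ := BalancedTensor.exists_left_of_character c
    have := key c h hh
    exact this.1.trans ((H h).trans this.2.symm)

/-- Puts the condition defining PGF in the same form as the one defining GP. -/
theorem ExactProjectiveComplex.tensorExact_iff (P : ExactProjectiveComplex R)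
    (I : Type u) [AddCommGroup I] [Module Rᵐᵒᵖ I] :
    P.TensorExact I ↔ P.HomExact (ModuleCat.of R (CharacterModule I)) :=
  forall_congr' fun i => exact_tensor_iff (P.d (i + 1)) (P.d i)

end Flat

/-! ### The equational criterion of flatness, and coherence -/

section EquationalFlatness

/-- The equational criterion of flatness: every linear relation in the module is a consequence of
linear relations in the ring. -/
def EquationallyFlat (R : Type u) [Ring R] (X : Type u) [AddCommGroup X] [Module R X] : Prop :=
  ∀ (ι : Type) [Fintype ι] (r : ι → R) (x : ι → X), ∑ i, r i • x i = 0 →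
    ∃ (κ : Type) (_ : Fintype κ) (y : ι → κ → R) (z : κ → X),
      (∀ i, x i = ∑ j, y i j • z j) ∧ ∀ j, ∑ i, r i * y i j = 0

variable {R : Type u} [Ring R]

/-- The criterion is stated for index types in `Type`, so the finite set is replaced by `Fin
s.card`. The coefficients outside `s` are a default 0. -/
theorem EquationallyFlat.exists_of_finset {X : Type u} [AddCommGroup X] [Module R X]
    (hX : EquationallyFlat R X) {α : Type*} (s : Finset α) (r : α → R) (x : α → X)
    (h : ∑ i ∈ s, r i • x i = 0) :
    ∃ (κ : Type) (_ : Fintype κ) (y : α → κ → R) (z : κ → X),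
      (∀ i ∈ s, x i = ∑ j, y i j • z j) ∧ ∀ j, ∑ i ∈ s, r i * y i j = 0 := by
  classical
  let e := s.equivFin
  have sum_eq : ∀ {A : Type u} [AddCommGroup A] (f : α → A),
      ∑ i ∈ s, f i = ∑ k, f (e.symm k) := fun f => by
    rw [← Finset.sum_coe_sort s f]
    exact (Equiv.sum_comp e.symm fun i : s => f i).symm
  obtain ⟨κ, hκ, y, z, hx, hr⟩ := hX (Fin s.card) (fun k => r (e.symm k)) (fun k => x (e.symm k))
    (by rw [← h, sum_eq fun i => r i • x i])
  refine ⟨κ, hκ, fun i => if hi : i ∈ s then y (e ⟨i, hi⟩) else 0, z, fun i hi => ?_, fun j => ?_⟩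
  · have := hx (e ⟨i, hi⟩)
    simpa [hi] using this
  · rw [sum_eq fun i => r i * _, ← hr j]
    refine Finset.sum_congr rfl fun k _ => ?_
    simp

/-- The map `g` descends to the quotient by `ker f`, which embeds in `B`. -/
theorem Module.Injective.exists_extension_of_ker_le {S : Type u} [Ring S] {Q A B : Type u}
    [AddCommGroup Q] [Module S Q] [AddCommGroup A] [Module S A] [AddCommGroup B] [Module S B]
    (hQ : Module.Injective S Q) (f : A →ₗ[S] B) (g : A →ₗ[S] Q)
    (h : ∀ a, f a = 0 → g a = 0) : ∃ g' : B →ₗ[S] Q, ∀ a, g' (f a) = g a := by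
  obtain ⟨g', hg'⟩ := hQ.out ((LinearMap.ker f).liftQ f le_rfl)
    (LinearMap.ker_eq_bot.1 (Submodule.ker_liftQ_eq_bot _ _ _ le_rfl))
    ((LinearMap.ker f).liftQ g fun a ha => h a ha)
  exact ⟨g', fun a => hg' (Submodule.Quotient.mk a)⟩

theorem CharacterModule.sum_apply {A : Type*} [AddCommGroup A] {ι : Type*} (s : Finset ι)
    (f : ι → CharacterModule A) (a : A) : (∑ i ∈ s, f i) a = ∑ i ∈ s, f i a := by
  classical
  induction s using Finset.induction_on with
  | empty => rfl
  | insert i s hi ih =>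
    rw [Finset.sum_insert hi, Finset.sum_insert hi, ← ih]
    rfl

theorem CharacterModule.apply_pi {A : Type u} [AddCommGroup A] {ι : Type} [Fintype ι]
    [DecidableEq ι] (c : CharacterModule (ι → A)) (x : ι → A) :
    c x = ∑ i, c (Pi.single i (x i)) := by
  conv_lhs => rw [← Finset.univ_sum_single x]
  rw [map_sum]

/-- It suffices that `x` lies in the subgroup `S` generated by the vectors a • z with a a solution
of the equation. A character of X^ι killing `S` has components f i in X⁺ that satisfy all relations
among the r i. By injectivity the map r i ↦ f i extends from the right ideal to R, and the character
takes `x` to g(1)(∑ r i • x i) = 0. -/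
theorem EquationallyFlat.of_injective {X : Type u} [AddCommGroup X] [Module R X]
    (hX : Module.Injective Rᵐᵒᵖ (CharacterModule X)) : EquationallyFlat R X := by
  classical
  intro ι _ r x hx
  let S : AddSubgroup (ι → X) := AddSubgroup.closure
    {w | ∃ (a : ι → R) (z : X), ∑ i, r i * a i = 0 ∧ w = fun i => a i • z}
  have mem : x ∈ S := by
    refine CharacterModule.mem_of_forall S x fun c hc => ?_
    let f : ι → CharacterModule X := fun i =>
      AddMonoidHom.comp c (AddMonoidHom.single (fun _ : ι => X) i)
    obtain ⟨g, hg⟩ := hX.exists_extension_of_ker_le (Fintype.linearCombination Rᵐᵒᵖ r)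
      (Fintype.linearCombination Rᵐᵒᵖ f) (fun a ha => by
        refine CharacterModule.ext _ fun z => ?_
        have hz := hc (fun i => (a i).unop • z) (AddSubgroup.subset_closure
          ⟨fun i => (a i).unop, z, by simpa [Fintype.linearCombination_apply] using ha, rfl⟩)
        rw [CharacterModule.apply_pi] at hz
        rw [Fintype.linearCombination_apply, CharacterModule.sum_apply]
        exact hz)
    have hf : ∀ i z, f i z = g 1 (r i • z) := fun i z => by
      have h1 := hg (Pi.single i 1)
      rw [Fintype.linearCombination_apply_single, Fintype.linearCombination_apply_single,
        one_smul, one_smul] at h1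
      calc f i z = g (MulOpposite.op (r i) • 1) z := by simp [← h1]
        _ = (MulOpposite.op (r i) • g 1) z := by rw [map_smul]
    rw [CharacterModule.apply_pi]
    calc ∑ i, c (Pi.single i (x i)) = ∑ i, g 1 (r i • x i) :=
          Finset.sum_congr rfl fun i _ => hf i (x i)
      _ = 0 := by rw [← map_sum, hx, map_zero]
  refine AddSubgroup.closure_induction
    (p := fun x _ => ∃ (κ : Type) (_ : Fintype κ) (y : ι → κ → R) (z : κ → X),
      (∀ i, x i = ∑ j, y i j • z j) ∧ ∀ j, ∑ i, r i * y i j = 0) ?_ ?_ ?_ ?_ mem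
  · rintro _ ⟨a, z, ha, rfl⟩
    exact ⟨Unit, inferInstance, fun i _ => a i, fun _ => z, by simp, fun _ => ha⟩
  · exact ⟨Empty, inferInstance, fun _ => Empty.elim, Empty.elim, by simp, fun j => j.elim⟩
  · rintro v w - - ⟨κ, _, y, z, hv, hy⟩ ⟨κ', _, y', z', hw, hy'⟩
    refine ⟨κ ⊕ κ', inferInstance, fun i => Sum.elim (y i) (y' i), Sum.elim z z',
      fun i => by simp [hv, hw], ?_⟩
    rintro (j | j)
    · exact hy j
    · exact hy' j
  · rintro v - ⟨κ, _, y, z, hv, hy⟩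
    exact ⟨κ, inferInstance, y, fun j => -z j, fun i => by simp [hv], hy⟩

/-- In Baer's criterion, a map g from a right ideal I to X⁺ amounts to a character on a direct sum
of copies of X indexed by I. The equational criterion shows that it vanishes on the kernel of
multiplication into X, so it comes from a character c of X, and g is s ↦ c · s. -/
theorem EquationallyFlat.injective {X : Type u} [AddCommGroup X] [Module R X]
    (hX : EquationallyFlat R X) : Module.Injective Rᵐᵒᵖ (CharacterModule X) := by
  classical
  refine Module.Baer.injective fun I g => ?_
  let T : (I →₀ X) →+ X := Finsupp.liftAddHom fun s => DistribSMul.toAddMonoidHom X s.1.unop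
  let G : (I →₀ X) →+ AddCircle (1 : ℚ) := Finsupp.liftAddHom fun s => (g s : X →+ _)
  obtain ⟨c, hc⟩ := CharacterModule.exists_extension_of_ker_le T G (fun t ht => by
    obtain ⟨κ, _, y, z, hx, hr⟩ := hX.exists_of_finset t.support (fun s => s.1.unop) t ht
    change ∑ s ∈ t.support, g s (t s) = 0
    have : ∀ s ∈ t.support, g s (t s) = ∑ j, (MulOpposite.op (y s j) • g s) (z j) := by
      intro s hs
      rw [hx s hs, map_sum]
      rfl
    rw [Finset.sum_congr rfl this, Finset.sum_comm]
    refine Finset.sum_eq_zero fun j _ => ?_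
    rw [← CharacterModule.sum_apply]
    have h0 : ∑ s ∈ t.support, MulOpposite.op (y s j) • s = 0 := by
      apply Subtype.ext
      rw [Submodule.coe_sum]
      apply MulOpposite.unop_injective
      simpa using hr j
    calc (∑ s ∈ t.support, MulOpposite.op (y s j) • g s) (z j)
        = g (∑ s ∈ t.support, MulOpposite.op (y s j) • s) (z j) := by
          rw [map_sum]
          simp only [map_smul]
      _ = 0 := by rw [h0, map_zero]; rfl)
  refine ⟨LinearMap.toSpanSingleton Rᵐᵒᵖ _ c, fun s hs => CharacterModule.ext _ fun x => ?_⟩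
  have hT : T (Finsupp.single ⟨s, hs⟩ x) = s.unop • x := Finsupp.liftAddHom_apply_single _ _ _
  have hG : G (Finsupp.single ⟨s, hs⟩ x) = g ⟨s, hs⟩ x := Finsupp.liftAddHom_apply_single _ _ _
  have := hc (Finsupp.single ⟨s, hs⟩ x)
  rw [hT] at this
  exact this.trans hG

theorem flatModules_iff_equationallyFlat (F : ModuleCat.{u} R) :
    flatModules R F ↔ EquationallyFlat R F :=
  (flatModules_iff_injective F).trans
    ⟨EquationallyFlat.of_injective, EquationallyFlat.injective⟩

theorem EquationallyFlat.of_projective {X : Type u} [AddCommGroup X] [Module R X]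
    (hX : Module.Projective R X) : EquationallyFlat R X := by
  classical
  obtain ⟨s, hs⟩ := hX.out
  intro ι _ r x hx
  -- The finitely many generators occurring in the coordinates of the `x i` serve as the new
  -- elements.
  let t : Finset X := Finset.univ.biUnion fun i => (s (x i)).support
  refine ⟨Fin t.card, inferInstance, fun i j => s (x i) (t.equivFin.symm j),
    fun j => t.equivFin.symm j, fun i => ?_, fun j => ?_⟩
  · refine (hs (x i)).symm.trans ?_
    rw [Finsupp.linearCombination_apply,
      Finsupp.sum_of_support_subset _ (Finset.subset_biUnion_of_mem
      (fun i => (s (x i)).support) (Finset.mem_univ i)) _ (by simp)]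
    change ∑ w ∈ t, _ = _
    rw [← Finset.sum_coe_sort t]
    exact (Equiv.sum_comp t.equivFin.symm fun w : t => s (x i) w • (w : X)).symm
  · have := congrArg (fun v : X →₀ R => v (t.equivFin.symm j)) (congrArg s hx)
    simpa [Finsupp.finsetSum_apply] using this

/-- Over a right coherent ring the solutions of a linear equation are finitely generated. -/
theorem IsRightCoherent.exists_generators (hR : IsRightCoherent R) {ι : Type} [Fintype ι]
    (r : ι → R) :
    ∃ (m : ℕ) (y : ι → Fin m → R), (∀ j, ∑ i, r i * y i j = 0) ∧
      ∀ a : ι → R, ∑ i, r i * a i = 0 → ∃ b : Fin m → R, ∀ i, a i = ∑ j, y i j * b j := by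
  classical
  let ρ : (ι → Rᵐᵒᵖ) →ₗ[Rᵐᵒᵖ] R := Fintype.linearCombination Rᵐᵒᵖ r
  -- The range of `ρ` is the right ideal generated by the `r i`. It is finitely presented, so the
  -- module of solutions, the kernel of `ρ`, is finitely generated.
  have := hR (LinearMap.range ρ) (Submodule.FG.of_finite)
  have hker := Module.FinitePresentation.fg_ker ρ.rangeRestrict ρ.surjective_rangeRestrict
  rw [LinearMap.ker_rangeRestrict] at hker
  obtain ⟨m, v, hv⟩ := Submodule.fg_iff_exists_fin_generating_family.1 hker
  have mem_ker : ∀ a : ι → Rᵐᵒᵖ, a ∈ LinearMap.ker ρ ↔ ∑ i, r i * (a i).unop = 0 := fun a => by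
    simp [ρ, Fintype.linearCombination_apply]
  refine ⟨m, fun i j => (v j i).unop, fun j => ?_, fun a ha => ?_⟩
  · exact (mem_ker (v j)).1 (hv ▸ Submodule.subset_span ⟨j, rfl⟩)
  · have := (mem_ker fun i => MulOpposite.op (a i)).2 ha
    rw [← hv, Submodule.mem_span_range_iff_exists_fun] at this
    obtain ⟨b, hb⟩ := this
    refine ⟨fun j => (b j).unop, fun i => ?_⟩
    have := congrArg MulOpposite.unop (congrFun hb i)
    simpa using this.symm

/-- Over a right coherent ring character modules of injective modules are flat. -/
theorem EquationallyFlat.of_isRightCoherent (hR : IsRightCoherent R) {I : Type u} [AddCommGroup I]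
    [Module Rᵐᵒᵖ I] (hI : Module.Injective Rᵐᵒᵖ I) : EquationallyFlat R (CharacterModule I) := by
  classical
  intro ι _ r f hf
  obtain ⟨m, y, hy, hgen⟩ := hR.exists_generators r
  let Φ : (ι → I) →+ (Fin m → I) := AddMonoidHom.mk'
    (fun x j => ∑ i, MulOpposite.op (y i j) • x i) fun x x' => by
      funext j
      simp [Finset.sum_add_distrib]
  let F : (ι → I) →+ AddCircle (1 : ℚ) := AddMonoidHom.mk' (fun x => ∑ i, f i (x i)) fun x x' => by
    simp [Finset.sum_add_distrib]
  -- If Φ x = 0, then x satisfies all relations among the r i, so by injectivity x i = g(1) · r i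
  -- for some g : R → I, and F x = (∑ r i • f i)(g 1) = 0. Hence F factors through Φ, and the
  -- components of the factor `c` are the required characters.
  obtain ⟨c, hc⟩ := CharacterModule.exists_extension_of_ker_le Φ F (fun x hx => by
    obtain ⟨g, hg⟩ := hI.exists_extension_of_ker_le (Fintype.linearCombination Rᵐᵒᵖ r)
      (Fintype.linearCombination Rᵐᵒᵖ x) (fun a ha => by
        obtain ⟨b, hb⟩ := hgen (fun i => (a i).unop)
          (by simpa [Fintype.linearCombination_apply] using ha)
        rw [Fintype.linearCombination_apply]
        have : ∀ i, a i • x i = ∑ j, MulOpposite.op (b j) • MulOpposite.op (y i j) • x i := by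
          intro i
          rw [← MulOpposite.op_unop (a i), hb i]
          simp only [Finset.op_sum, MulOpposite.op_mul, Finset.sum_smul, mul_smul]
        simp only [this]
        rw [Finset.sum_comm]
        refine Finset.sum_eq_zero fun j _ => ?_
        rw [← Finset.smul_sum]
        have hj : ∑ i, MulOpposite.op (y i j) • x i = 0 := congrFun hx j
        rw [hj, smul_zero])
    have hx' : ∀ i, x i = MulOpposite.op (r i) • g 1 := fun i => by
      have h1 := hg (Pi.single i 1)
      rw [Fintype.linearCombination_apply_single, Fintype.linearCombination_apply_single,
        one_smul, one_smul] at h1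
      rw [← h1, ← map_smul]
      simp
    change ∑ i, f i (x i) = 0
    calc ∑ i, f i (x i) = (∑ i, r i • f i) (g 1) := by
          rw [CharacterModule.sum_apply]
          exact Finset.sum_congr rfl fun i _ => congrArg (f i) (hx' i)
      _ = 0 := by rw [hf]; rfl)
  refine ⟨Fin m, inferInstance, y, fun j =>
    AddMonoidHom.comp c (AddMonoidHom.single (fun _ : Fin m => I) j), fun i => ?_, hy⟩
  refine CharacterModule.ext _ fun x => ?_
  rw [CharacterModule.sum_apply]
  have h1 : F (Pi.single i x) = f i x := by
    change ∑ k, f k ((Pi.single i x : ι → I) k) = _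
    rw [Finset.sum_eq_single i (fun k _ hk => by rw [Pi.single_eq_of_ne hk, map_zero])
      (fun h => absurd (Finset.mem_univ i) h), Pi.single_eq_same]
  have h2 : ∀ j, Φ (Pi.single i x) j = MulOpposite.op (y i j) • x := fun j => by
    change ∑ k, MulOpposite.op (y k j) • (Pi.single i x : ι → I) k = _
    rw [Finset.sum_eq_single i (fun k _ hk => by rw [Pi.single_eq_of_ne hk, smul_zero])
      (fun h => absurd (Finset.mem_univ i) h), Pi.single_eq_same]
  refine h1.symm.trans ((hc _).symm.trans ((CharacterModule.apply_pi c _).trans ?_))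
  refine Finset.sum_congr rfl fun j _ => ?_
  rw [h2]
  rfl

/-- Over a right coherent ring products of flat modules are flat. -/
theorem EquationallyFlat.pi (hR : IsRightCoherent R) {α : Type} {X : α → Type u}
    [∀ a, AddCommGroup (X a)] [∀ a, Module R (X a)] (hX : ∀ a, EquationallyFlat R (X a)) :
    EquationallyFlat R (∀ a, X a) := by
  intro ι _ r x hx
  -- The generators `y` depend on `r` only, so they serve all factors simultaneously.
  obtain ⟨m, y, hy, hgen⟩ := hR.exists_generators r
  have : ∀ a, ∃ z : Fin m → X a, ∀ i, x i a = ∑ j, y i j • z j := by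
    intro a
    obtain ⟨κ, _, y', z', hx', hr'⟩ := hX a ι r (fun i => x i a) (by simpa using congrFun hx a)
    choose b hb using fun l => hgen (fun i => y' i l) (hr' l)
    refine ⟨fun j => ∑ l, b l j • z' l, fun i => ?_⟩
    simp only [hx', hb, Finset.smul_sum, smul_smul, Finset.sum_smul]
    exact Finset.sum_comm
  choose z hz using this
  refine ⟨Fin m, inferInstance, y, fun j a => z a j, fun i => ?_, hy⟩
  funext a
  simp [hz]

end EquationalFlatness

open scoped DualNumber

/-! ### Telescopes of free modules over a flat module -/

section Telescope

variable {S : Type u} [Ring S] {C : Type u} [AddCommGroup C] [Module S C]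

/-- A map from a free module to a flat module can be modified so as to kill a given element of its
kernel. -/
theorem EquationallyFlat.exists_factorization (hC : EquationallyFlat S C)
    (f : (ℕ →₀ S) →ₗ[S] C) (v : ℕ →₀ S) (hv : f v = 0) :
    ∃ (t : (ℕ →₀ S) →ₗ[S] (ℕ →₀ S)) (f' : (ℕ →₀ S) →ₗ[S] C), f' ∘ₗ t = f ∧ t v = 0 := by
  classical
  obtain ⟨κ, _, y, z, hx, hr⟩ := hC.exists_of_finset v.support v (fun i => f (Finsupp.single i 1))
    (by
      conv_rhs => rw [← hv, ← Finsupp.sum_single v]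
      rw [Finsupp.sum, map_sum]
      refine Finset.sum_congr rfl fun i _ => ?_
      rw [← map_smul, Finsupp.smul_single, smul_eq_mul, mul_one])
  -- Basis vectors in the support of `v` are sent to combinations of κ new ones. Reindexing by ℕ
  -- keeps the shape of the free module, so that the construction can be iterated.
  obtain ⟨e⟩ : Nonempty (ℕ ⊕ κ ≃ ℕ) := nonempty_equiv_of_countable
  let E := Finsupp.domLCongr (M := S) (R := S) e
  let w : ℕ → (ℕ ⊕ κ →₀ S) := fun i =>
    if i ∈ v.support then ∑ j, y i j • Finsupp.single (Sum.inr j) 1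
    else Finsupp.single (Sum.inl i) 1
  let g : (ℕ ⊕ κ →₀ S) →ₗ[S] C :=
    Finsupp.linearCombination S (Sum.elim (fun i => f (Finsupp.single i 1)) z)
  refine ⟨E.toLinearMap ∘ₗ Finsupp.linearCombination S w, g ∘ₗ E.symm.toLinearMap, ?_, ?_⟩
  · refine Finsupp.lhom_ext' fun i => LinearMap.ext_ring ?_
    have : g (w i) = f (Finsupp.single i 1) := by
      by_cases hi : i ∈ v.support
      · simp only [w, if_pos hi, map_sum, map_smul, hx i hi]
        simp [g]
      · simp only [w, if_neg hi]
        simp [g]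
    simpa using this
  · have : Finsupp.linearCombination S w v = 0 := by
      rw [Finsupp.linearCombination_apply, Finsupp.sum]
      have hw : ∀ i ∈ v.support, v i • w i =
          ∑ j, (v i * y i j) • Finsupp.single (Sum.inr j) (1 : S) := fun i hi => by
        simp only [w, if_pos hi, Finset.smul_sum, smul_smul]
      rw [Finset.sum_congr rfl hw, Finset.sum_comm]
      refine Finset.sum_eq_zero fun j _ => ?_
      rw [← Finset.sum_smul, hr, zero_smul]
    rw [LinearMap.comp_apply, this, map_zero]

/-- A map from a free module to a flat module that kills countably many elements `rel j` factors
through a module with a free resolution of length one, in which these elements vanish. -/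
theorem EquationallyFlat.exists_telescope (hC : EquationallyFlat S C)
    (f : (ℕ →₀ S) →ₗ[S] C) (rel : ℕ → (ℕ →₀ S)) (hrel : ∀ j, f (rel j) = 0) :
    ∃ (τ : (ℕ × ℕ →₀ S) →ₗ[S] (ℕ × ℕ →₀ S)) (p : (ℕ × ℕ →₀ S) →ₗ[S] C)
      (i : (ℕ →₀ S) →ₗ[S] (ℕ × ℕ →₀ S)),
      Function.Injective τ ∧ (∀ x, p (τ x) = 0) ∧ (∀ x, p (i x) = f x) ∧
        ∀ j, ∃ x, τ x = i (rel j) := by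
  -- A stage of the telescope: the composite transition map from the initial free module, and the
  -- map from the stage to `C`.
  let St := {q : ((ℕ →₀ S) →ₗ[S] (ℕ →₀ S)) × ((ℕ →₀ S) →ₗ[S] C) // q.2 ∘ₗ q.1 = f}
  have step : ∀ (q : St) (k : ℕ), ∃ (t : (ℕ →₀ S) →ₗ[S] (ℕ →₀ S)) (f' : (ℕ →₀ S) →ₗ[S] C),
      f' ∘ₗ t = q.1.2 ∧ t (q.1.1 (rel k)) = 0 := fun q k =>
    hC.exists_factorization q.1.2 (q.1.1 (rel k)) (by rw [← LinearMap.comp_apply, q.2, hrel])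
  choose t f' hf' ht using step
  let q : ℕ → St := fun k => Nat.rec ⟨(LinearMap.id, f), LinearMap.comp_id f⟩
    (fun k q => ⟨(t q k ∘ₗ q.1.1, f' q k), by
      rw [← LinearMap.comp_assoc, hf', q.2]⟩) k
  let inj : ∀ k : ℕ, (ℕ →₀ S) →ₗ[S] (ℕ × ℕ →₀ S) := fun k => Finsupp.lmapDomain S S (Prod.mk k)
  let pr : ∀ k : ℕ, (ℕ × ℕ →₀ S) →ₗ[S] (ℕ →₀ S) := fun k =>
    Finsupp.lcomapDomain (Prod.mk k) (Prod.mk_right_injective k)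
  -- The shift applies the transition from each stage to the next; the cokernel of `id - sh` is the
  -- colimit of the stages.
  let sh : (ℕ × ℕ →₀ S) →ₗ[S] (ℕ × ℕ →₀ S) := Finsupp.linearCombination S fun a =>
    inj (a.1 + 1) (t (q a.1) a.1 (Finsupp.single a.2 1))
  let p : (ℕ × ℕ →₀ S) →ₗ[S] C := Finsupp.linearCombination S fun a =>
    (q a.1).1.2 (Finsupp.single a.2 1)
  have inj_single : ∀ k i, inj k (Finsupp.single i 1) = Finsupp.single (k, i) 1 := fun k i => by
    simp [inj]
  have hom_ext : ∀ {M : Type u} [AddCommGroup M] [Module S M] {g g' : (ℕ × ℕ →₀ S) →ₗ[S] M},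
      (∀ k i, g (inj k (Finsupp.single i 1)) = g' (inj k (Finsupp.single i 1))) → g = g' :=
    fun h => Finsupp.lhom_ext' fun a => LinearMap.ext_ring (by
      have := h a.1 a.2
      rw [inj_single] at this
      exact this)
  have sh_inj : ∀ k w, sh (inj k w) = inj (k + 1) (t (q k) k w) := fun k w => by
    have : sh ∘ₗ inj k = inj (k + 1) ∘ₗ t (q k) k :=
      Finsupp.lhom_ext' fun i => LinearMap.ext_ring (by
        change sh (inj k (Finsupp.single i 1)) = _
        rw [inj_single]
        simp [sh])
    exact LinearMap.congr_fun this w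
  have p_inj : ∀ k w, p (inj k w) = (q k).1.2 w := fun k w => by
    have : p ∘ₗ inj k = (q k).1.2 :=
      Finsupp.lhom_ext' fun i => LinearMap.ext_ring (by
        change p (inj k (Finsupp.single i 1)) = _
        rw [inj_single]
        simp [p])
    exact LinearMap.congr_fun this w
  have pr_inj : ∀ k w, pr k (inj k w) = w := fun k w => by
    ext i
    exact Finsupp.mapDomain_apply (Prod.mk_right_injective k) w i
  have pr_inj_of_ne : ∀ k l w, k ≠ l → pr k (inj l w) = 0 := fun k l w h => by
    ext i
    exact Finsupp.mapDomain_of_notMem_range w _ (by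
      rintro ⟨j, hj⟩; exact h (Prod.ext_iff.1 hj).1.symm)
  have sh_zero : ∀ x, pr 0 (sh x) = 0 := fun x => by
    have : pr 0 ∘ₗ sh = 0 := hom_ext fun k i => by
      rw [LinearMap.comp_apply, sh_inj, pr_inj_of_ne _ _ _ k.succ_ne_zero.symm,
        LinearMap.zero_apply]
    exact LinearMap.congr_fun this x
  have sh_succ : ∀ k x, pr (k + 1) (sh x) = t (q k) k (pr k x) := fun k x => by
    have : pr (k + 1) ∘ₗ sh = t (q k) k ∘ₗ pr k := hom_ext fun l i => by
      rw [LinearMap.comp_apply, sh_inj, LinearMap.comp_apply]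
      by_cases h : k = l
      · subst h
        rw [pr_inj, pr_inj]
      · rw [pr_inj_of_ne _ _ _ h, pr_inj_of_ne _ _ _ (by omega), map_zero]
    exact LinearMap.congr_fun this x
  refine ⟨LinearMap.id - sh, p, inj 0, ?_, ?_, fun x => p_inj 0 x, fun j => ?_⟩
  · refine (injective_iff_map_eq_zero _).2 fun x hx => ?_
    have hx' : x = sh x := sub_eq_zero.1 hx
    -- In x = sh x, component 0 vanishes and component k + 1 is determined by component k.
    have : ∀ k, pr k x = 0 := fun k => by
      induction k with
      | zero => rw [hx', sh_zero]
      | succ k ih => rw [hx', sh_succ, ih, map_zero]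
    ext ⟨k, i⟩
    exact DFunLike.congr_fun (this k) i
  · have : p ∘ₗ (LinearMap.id - sh) = 0 := hom_ext fun k w => by
      rw [LinearMap.comp_apply, LinearMap.sub_apply, LinearMap.id_apply, map_sub, sh_inj,
        p_inj, p_inj, LinearMap.zero_apply, sub_eq_zero, ← hf' (q k) k]
      rfl
    exact fun x => LinearMap.congr_fun this x
  · have key : ∀ (k : ℕ) (v : ℕ →₀ S), ∃ x,
        x - sh x = inj 0 v - inj k ((q k).1.1 v) := by
      intro k v
      induction k with
      | zero => exact ⟨0, by rw [map_zero, sub_self]; exact (sub_self _).symm⟩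
      | succ k ih =>
        obtain ⟨x, hx⟩ := ih
        refine ⟨x + inj k ((q k).1.1 v), ?_⟩
        rw [map_add, add_sub_add_comm, hx, sh_inj]
        exact sub_add_sub_cancel _ _ _
    -- The transition from stage j to stage j + 1 is the one that kills `rel j`.
    obtain ⟨x, hx⟩ := key (j + 1) (rel j)
    have h0 : (q (j + 1)).1.1 (rel j) = 0 := ht (q j) j
    exact ⟨x, hx.trans (by rw [h0, map_zero, sub_zero])⟩

end Telescope

/-! ### Differential modules as modules over the dual numbers -/

section DifferentialModules

variable {R : Type u} [Ring R]

instance DualNumber.isScalarTower_self : IsScalarTower R R[ε] R[ε] :=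
  ⟨fun r a b => by ext <;> simp [mul_assoc, mul_add]⟩

theorem DualNumber.smul_eq {C : Type u} [AddCommGroup C] [Module R C] [Module R[ε] C]
    [IsScalarTower R R[ε] C] (a : R[ε]) (c : C) :
    a • c = a.fst • c + a.snd • (ε : R[ε]) • c := by
  have : a = a.fst • (1 : R[ε]) + a.snd • (ε : R[ε]) := by ext <;> simp
  conv_lhs => rw [this]
  rw [add_smul, smul_assoc, smul_assoc, one_smul]

theorem DualNumber.eps_smul_eps_smul {C : Type u} [AddCommGroup C] [Module R[ε] C] (c : C) :
    (ε : R[ε]) • (ε : R[ε]) • c = 0 := by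
  rw [smul_smul, DualNumber.eps_mul_eps, zero_smul]

variable (R) in
/-- The differential of a module over the dual numbers. -/
def DualNumber.differential (C : Type u) [AddCommGroup C] [Module R C] [Module R[ε] C]
    [IsScalarTower R R[ε] C] : C →ₗ[R] C where
  toFun c := (ε : R[ε]) • c
  map_add' := smul_add _
  map_smul' r c := by
    have : (ε : R[ε]) * (r • 1) = r • ε := by ext <;> simp
    rw [RingHom.id_apply, ← smul_assoc r, ← this, mul_smul, smul_assoc, one_smul]

theorem DualNumber.differential_apply {C : Type u} [AddCommGroup C] [Module R C] [Module R[ε] C]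
    [IsScalarTower R R[ε] C] (c : C) : differential R C c = (ε : R[ε]) • c := rfl

/-- A module with a square zero endomorphism is a module over the dual numbers. -/
abbrev DualNumber.moduleOfDifferential {C : Type u} [AddCommGroup C] [Module R C]
    (δ : C →ₗ[R] C) (hδ : ∀ c, δ (δ c) = 0) : Module R[ε] C where
  smul a c := a.fst • c + a.snd • δ c
  one_smul c := by
    change (1 : R[ε]).fst • c + (1 : R[ε]).snd • δ c = c
    simp
  mul_smul a b c := by
    change (a * b).fst • c + (a * b).snd • δ c =
      a.fst • (b.fst • c + b.snd • δ c) + a.snd • δ (b.fst • c + b.snd • δ c)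
    simp [mul_smul, add_smul, hδ]
    abel
  smul_zero a := by
    change a.fst • (0 : C) + a.snd • δ 0 = 0
    simp
  smul_add a c c' := by
    change a.fst • (c + c') + a.snd • δ (c + c') = a.fst • c + a.snd • δ c +
      (a.fst • c' + a.snd • δ c')
    rw [map_add, smul_add, smul_add]
    abel
  add_smul a b c := by
    change (a + b).fst • c + (a + b).snd • δ c = a.fst • c + a.snd • δ c +
      (b.fst • c + b.snd • δ c)
    rw [TrivSqZeroExt.fst_add, TrivSqZeroExt.snd_add, add_smul, add_smul]
    abel
  zero_smul c := by
    change (0 : R[ε]).fst • c + (0 : R[ε]).snd • δ c = 0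
    simp

/-- An exact differential module with flat cycles is flat over the dual numbers. -/
theorem EquationallyFlat.dualNumber {C : Type u} [AddCommGroup C] [Module R C] [Module R[ε] C]
    [IsScalarTower R R[ε] C] (hexact : ∀ c : C, (ε : R[ε]) • c = 0 → ∃ c', c = (ε : R[ε]) • c')
    (hD : EquationallyFlat R (LinearMap.ker (DualNumber.differential R C))) :
    EquationallyFlat R[ε] C := by
  intro ι _ a x hx
  rw [Finset.sum_congr rfl fun i _ => DualNumber.smul_eq (a i) (x i), Finset.sum_add_distrib] at hx
  have mem : ∀ c : C, (ε : R[ε]) • c ∈ LinearMap.ker (DualNumber.differential R C) := fun c =>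
    DualNumber.eps_smul_eps_smul c
  have eps_smul : ∀ (r : R) (c : C), (ε : R[ε]) • r • c = r • (ε : R[ε]) • c := fun r c =>
    map_smul (DualNumber.differential R C) r c
  -- Multiplying the relation by ε leaves a relation over R between the cycles ε • x i.
  have hx1 : ∑ i, (a i).fst • (⟨ε • x i, mem (x i)⟩ : LinearMap.ker (DualNumber.differential R C))
      = 0 := by
    apply Subtype.ext
    have := congrArg (fun c => (ε : R[ε]) • c) hx
    simp only [smul_add, Finset.smul_sum, eps_smul, DualNumber.eps_smul_eps_smul, smul_zero,
      Finset.sum_const_zero, add_zero] at this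
    simpa using this
  obtain ⟨κ, _, y, v, hv, hy⟩ := hD ι (fun i => (a i).fst) _ hx1
  choose w hw using fun j => hexact (v j).1 (v j).2
  have hv' : ∀ i, (ε : R[ε]) • x i = ∑ j, y i j • (ε : R[ε]) • w j := fun i => by
    have := congrArg Subtype.val (hv i)
    simpa [hw] using this
  have mem' : ∀ i, x i - ∑ j, y i j • w j ∈ LinearMap.ker (DualNumber.differential R C) := by
    intro i
    change (ε : R[ε]) • (x i - ∑ j, y i j • w j) = 0
    rw [smul_sub, hv', Finset.smul_sum, sub_eq_zero]
    exact Finset.sum_congr rfl fun j _ => (eps_smul _ _).symm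
  have hy' : ∑ i, (a i).fst • ∑ j, y i j • w j = 0 := by
    simp only [Finset.smul_sum, smul_smul]
    rw [Finset.sum_comm]
    simp only [← Finset.sum_smul, hy, zero_smul, Finset.sum_const_zero]
  -- After subtracting ∑ y i j • w j from x i, the original relation becomes one over R between
  -- cycles, and the criterion applies a second time.
  obtain ⟨κ', _, z, p, hp, hz⟩ := hD (ι ⊕ κ)
    (Sum.elim (fun i => (a i).fst) fun j => ∑ i, (a i).snd * y i j)
    (Sum.elim (fun i => ⟨_, mem' i⟩) v) (by
      apply Subtype.ext
      rw [Fintype.sum_sum_type]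
      simp only [Sum.elim_inl, Sum.elim_inr, Submodule.coe_add, Submodule.coe_sum,
        Submodule.coe_smul, smul_sub, Finset.sum_sub_distrib, hy', sub_zero, hw]
      rw [Submodule.coe_zero, ← hx]
      congr 1
      simp only [hv', Finset.smul_sum, Finset.sum_smul, smul_smul]
      exact Finset.sum_comm)
  choose p' hp' using fun l => hexact (p l).1 (p l).2
  have hpl : ∀ i, x i - ∑ j, y i j • w j = ∑ l, z (Sum.inl i) l • (ε : R[ε]) • p' l := fun i => by
    have := congrArg Subtype.val (hp (Sum.inl i))
    simpa [hp'] using this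
  have hpr : ∀ j, (ε : R[ε]) • w j = ∑ l, z (Sum.inr j) l • (ε : R[ε]) • p' l := fun j => by
    have := congrArg Subtype.val (hp (Sum.inr j))
    simpa [hp', hw] using this
  -- The preimages `w j` are determined only modulo cycles; the discrepancy is a boundary, and the
  -- `w' j` enter as further new elements with coefficients in ε R.
  have hw2 : ∀ j, ∃ c, w j - ∑ l, z (Sum.inr j) l • p' l = (ε : R[ε]) • c := fun j => by
    refine hexact _ ?_
    rw [smul_sub, hpr, Finset.smul_sum, sub_eq_zero]
    exact Finset.sum_congr rfl fun j _ => (eps_smul _ _).symm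
  choose w' hw' using hw2
  refine ⟨κ' ⊕ κ, inferInstance, fun i => Sum.elim
    (fun l => TrivSqZeroExt.inl (∑ j, y i j * z (Sum.inr j) l) +
      TrivSqZeroExt.inr (z (Sum.inl i) l))
    (fun j => TrivSqZeroExt.inr (y i j)), Sum.elim p' w', fun i => ?_, ?_⟩
  · have h1 : x i = (∑ l, z (Sum.inl i) l • (ε : R[ε]) • p' l) +
        ∑ j, y i j • ((∑ l, z (Sum.inr j) l • p' l) + (ε : R[ε]) • w' j) := by
      rw [← hpl]
      simp only [← hw', add_sub_cancel, sub_add_cancel]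
    rw [h1, Fintype.sum_sum_type]
    simp only [Sum.elim_inl, Sum.elim_inr, DualNumber.smul_eq (C := C) (_ + _),
      DualNumber.smul_eq (C := C) (TrivSqZeroExt.inr _), TrivSqZeroExt.fst_add,
      TrivSqZeroExt.snd_add, TrivSqZeroExt.fst_inl, TrivSqZeroExt.fst_inr, TrivSqZeroExt.snd_inl,
      TrivSqZeroExt.snd_inr, add_zero, zero_add, zero_smul, smul_add, Finset.sum_add_distrib,
      Finset.smul_sum, Finset.sum_smul, smul_smul]
    rw [Finset.sum_comm (s := (Finset.univ : Finset κ))]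
    abel
  · rintro (l | j)
    · have hzl := hz l
      rw [Fintype.sum_sum_type] at hzl
      simp only [Sum.elim_inl, Sum.elim_inr] at hzl
      ext
      · simp only [Sum.elim_inl, TrivSqZeroExt.fst_sum, TrivSqZeroExt.fst_mul,
          TrivSqZeroExt.fst_add, TrivSqZeroExt.fst_inl, TrivSqZeroExt.fst_inr, add_zero,
          TrivSqZeroExt.fst_zero, Finset.mul_sum, ← mul_assoc]
        rw [Finset.sum_comm]
        simp only [← Finset.sum_mul, hy, zero_mul, Finset.sum_const_zero]
      · simp only [Sum.elim_inl, TrivSqZeroExt.snd_sum, TrivSqZeroExt.snd_mul,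
          TrivSqZeroExt.fst_add, TrivSqZeroExt.fst_inl, TrivSqZeroExt.fst_inr, add_zero,
          TrivSqZeroExt.snd_add, TrivSqZeroExt.snd_inl, TrivSqZeroExt.snd_inr, zero_add,
          TrivSqZeroExt.snd_zero, smul_eq_mul, MulOpposite.smul_eq_mul_unop,
          MulOpposite.unop_op, Finset.sum_add_distrib]
        rw [← hzl]
        congr 1
        simp only [Finset.mul_sum, Finset.sum_mul, ← mul_assoc]
        exact Finset.sum_comm
    · ext
      · simp [TrivSqZeroExt.fst_sum]
      · simpa [TrivSqZeroExt.snd_sum] using hy j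

end DifferentialModules

/-! ### Null-homotopy of chain maps into flat differential modules -/

section NullHomotopy

variable {R : Type u} [Ring R] {C : Type u} [AddCommGroup C] [Module R C] [Module R[ε] C]
  [IsScalarTower R R[ε] C]

/-- Multiplication by ε carries the constant term isomorphically to the ε-coefficient; moving the
latter back is a contraction. -/
theorem DualNumber.exists_contraction (α : Type) :
    ∃ σ : (α →₀ R[ε]) →ₗ[R] (α →₀ R[ε]),
      ∀ x, σ ((ε : R[ε]) • x) + (ε : R[ε]) • σ x = x := by
  let h : R[ε] →ₗ[R] R[ε] :=
    { toFun := fun a => TrivSqZeroExt.inl a.snd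
      map_add' := fun a b => by simp
      map_smul' := fun r a => by ext <;> simp }
  refine ⟨Finsupp.mapRange.linearMap h, fun x => ?_⟩
  ext a
  · simp [h]
  · simp [h]

/-- Chain maps from a differential module that is free on a countable set to a differential module
that is flat over the dual numbers are null-homotopic. -/
theorem EquationallyFlat.exists_homotopy_of_countable (hC : EquationallyFlat R[ε] C)
    {U : Type u} [Countable U] (d : (U →₀ R) →ₗ[R] (U →₀ R)) (hd : ∀ x, d (d x) = 0)
    (φ : (U →₀ R) →ₗ[R] C) (hφ : ∀ x, φ (d x) = (ε : R[ε]) • φ x) :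
    ∃ s : (U →₀ R) →ₗ[R] C, ∀ x, φ x = s (d x) + (ε : R[ε]) • s x := by
  classical
  obtain ⟨e, he⟩ := exists_injective_nat U
  let f : (ℕ →₀ R[ε]) →ₗ[R[ε]] C :=
    Finsupp.linearCombination _ (Function.extend e (fun b => φ (Finsupp.single b 1)) 0)
  let ψ₀ : (U →₀ R) →ₗ[R] (ℕ →₀ R[ε]) :=
    Finsupp.linearCombination R fun b => Finsupp.single (e b) (1 : R[ε])
  have hfψ : ∀ x, f (ψ₀ x) = φ x := fun x => by
    have : f.restrictScalars R ∘ₗ ψ₀ = φ := Finsupp.lhom_ext' fun b => LinearMap.ext_ring (by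
      simp [f, ψ₀, he.extend_apply])
    exact LinearMap.congr_fun this x
  -- The failure of `ψ₀` to commute with the differentials, on each basis element, padded by 0
  -- outside the range of `e`. It is killed by `f`, because f ∘ ψ₀ = φ is a chain map.
  let rel : ℕ → (ℕ →₀ R[ε]) := Function.extend e
    (fun b => (ε : R[ε]) • ψ₀ (Finsupp.single b 1) - ψ₀ (d (Finsupp.single b 1))) 0
  have hrel : ∀ j, f (rel j) = 0 := fun j => by
    by_cases hj : ∃ b, e b = j
    · obtain ⟨b, rfl⟩ := hj
      simp only [rel]
      rw [he.extend_apply, map_sub, map_smul, hfψ, hfψ, hφ, sub_self]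
    · simp only [rel]
      rw [Function.extend_apply' _ _ _ hj, Pi.zero_apply, map_zero]
  obtain ⟨τ, p, i, hτ, hpτ, hpi, hx⟩ := hC.exists_telescope f rel hrel
  obtain ⟨σ, hσ⟩ := DualNumber.exists_contraction (R := R) (ℕ × ℕ)
  choose ρ₀ hρ₀ using hx
  let ρ : (U →₀ R) →ₗ[R] (ℕ × ℕ →₀ R[ε]) := Finsupp.linearCombination R fun b => ρ₀ (e b)
  have hρ : ∀ x, τ (ρ x) = (ε : R[ε]) • i (ψ₀ x) - i (ψ₀ (d x)) := fun x => by
    have : τ.restrictScalars R ∘ₗ ρ = DualNumber.differential R _ ∘ₗ i.restrictScalars R ∘ₗ ψ₀ -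
        i.restrictScalars R ∘ₗ ψ₀ ∘ₗ d := Finsupp.lhom_ext' fun b => LinearMap.ext_ring (by
      have h1 : ρ (Finsupp.single b 1) = ρ₀ (e b) := by simp [ρ]
      change τ (ρ (Finsupp.single b 1)) = (ε : R[ε]) • i (ψ₀ (Finsupp.single b 1)) -
        i (ψ₀ (d (Finsupp.single b 1)))
      rw [h1, hρ₀]
      simp only [rel]
      rw [he.extend_apply, map_sub, map_smul])
    exact LinearMap.congr_fun this x
  -- The defect of i ∘ ψ₀ anticommutes with the differentials, and so does its lift `ρ` since `τ` is
  -- injective.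
  have hρd : ∀ x, ρ (d x) = -((ε : R[ε]) • ρ x) := fun x => by
    apply hτ
    rw [hρ, hd, map_zero, map_zero, sub_zero, map_neg, map_smul, hρ, smul_sub,
      DualNumber.eps_smul_eps_smul, zero_sub, neg_neg]
  -- The contraction makes τ ∘ σ ∘ ρ have the same defect as i ∘ ψ₀, so the difference is a chain
  -- map into a free R[ε]-module; p ∘ τ = 0 ensures that it still lifts `φ`.
  let ψ : (U →₀ R) →ₗ[R] (ℕ × ℕ →₀ R[ε]) :=
    i.restrictScalars R ∘ₗ ψ₀ - τ.restrictScalars R ∘ₗ σ ∘ₗ ρ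
  have hψ : ∀ x, ψ x = i (ψ₀ x) - τ (σ (ρ x)) := fun x => rfl
  have hpψ : ∀ x, p (ψ x) = φ x := fun x => by
    rw [hψ, map_sub, hpτ, sub_zero, hpi, hfψ]
  have hψd : ∀ x, ψ (d x) = (ε : R[ε]) • ψ x := fun x => by
    have h1 := hσ (ρ x)
    rw [hψ, hψ, smul_sub, hρd, map_neg, map_neg, sub_neg_eq_add, ← map_smul τ,
      ← sub_eq_zero]
    have h2 : τ (ρ x) = τ (σ ((ε : R[ε]) • ρ x)) + τ ((ε : R[ε]) • σ (ρ x)) := by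
      rw [← map_add, h1]
    rw [hρ] at h2
    have h3 := sub_eq_zero.2 h2.symm
    rw [← h3]
    abel
  refine ⟨p.restrictScalars R ∘ₗ σ ∘ₗ ψ, fun x => ?_⟩
  change φ x = p (σ (ψ (d x))) + (ε : R[ε]) • p (σ (ψ x))
  rw [← map_smul p, ← map_add, hψd, hσ, hpψ]

theorem LinearMap.eq_of_forall_mem_support {U M : Type*} [AddCommGroup M] [Module R M]
    {f g : (U →₀ R) →ₗ[R] M} {x : U →₀ R}
    (h : ∀ b ∈ x.support, f (Finsupp.single b 1) = g (Finsupp.single b 1)) : f x = g x := by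
  rw [← Finsupp.sum_single x, Finsupp.sum, map_sum, map_sum]
  refine Finset.sum_congr rfl fun b hb => ?_
  rw [← mul_one (x b), ← smul_eq_mul, ← Finsupp.smul_single, map_smul, map_smul, h b hb]

/-- Every basis element of a free differential module lies in a countable set of basis elements
that spans a differential submodule. -/
theorem exists_countable_closed {U : Type u} (d : (U →₀ R) →ₗ[R] (U →₀ R)) (b : U) :
    ∃ T : Set U, T.Countable ∧ b ∈ T ∧
      ∀ x ∈ T, ∀ y ∈ (d (Finsupp.single x 1)).support, y ∈ T := by
  let T : ℕ → Set U := fun n => Nat.rec {b}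
    (fun _ T => ⋃ x ∈ T, ((d (Finsupp.single x 1)).support : Set U)) n
  refine ⟨⋃ n, T n, Set.countable_iUnion fun n => ?_, Set.mem_iUnion.2 ⟨0, rfl⟩, ?_⟩
  · induction n with
    | zero => exact Set.countable_singleton b
    | succ n ih => exact ih.biUnion fun x _ => Finset.countable_toSet _
  · intro x hx y hy
    obtain ⟨n, hn⟩ := Set.mem_iUnion.1 hx
    exact Set.mem_iUnion.2 ⟨n + 1, Set.mem_biUnion hn hy⟩

/-- A null-homotopy on the differential submodule spanned by a set of basis elements extends to a
countable enlargement of this set. -/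
theorem EquationallyFlat.exists_homotopy_extension (hC : EquationallyFlat R[ε] C)
    {B : Type u} (d : (B →₀ R) →ₗ[R] (B →₀ R)) (hd : ∀ x, d (d x) = 0)
    (φ : (B →₀ R) →ₗ[R] C) (hφ : ∀ x, φ (d x) = (ε : R[ε]) • φ x)
    (S T : Set B) (hS : ∀ x ∈ S, ∀ y ∈ (d (Finsupp.single x 1)).support, y ∈ S)
    (hT : ∀ x ∈ T, ∀ y ∈ (d (Finsupp.single x 1)).support, y ∈ T) (hTc : T.Countable)
    (s : (B →₀ R) →ₗ[R] C)
    (hs : ∀ b ∈ S, φ (Finsupp.single b 1) =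
      s (d (Finsupp.single b 1)) + (ε : R[ε]) • s (Finsupp.single b 1)) :
    ∃ s' : (B →₀ R) →ₗ[R] C,
      (∀ b ∈ S, s' (Finsupp.single b 1) = s (Finsupp.single b 1)) ∧
      ∀ b ∈ S ∪ T, φ (Finsupp.single b 1) =
        s' (d (Finsupp.single b 1)) + (ε : R[ε]) • s' (Finsupp.single b 1) := by
  classical
  -- The free module on `U` models the span of S ∪ T modulo the span of S, with differential res ∘ d
  -- ∘ inc. Maps vanishing on S pass to this quotient, which has a countable basis.
  let U : Set B := T \ S
  have : Countable U := (hTc.mono Set.sdiff_subset).to_subtype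
  let res : (B →₀ R) →ₗ[R] (U →₀ R) := Finsupp.lsubtypeDomain U
  let inc : (U →₀ R) →ₗ[R] (B →₀ R) := Finsupp.lmapDomain R R Subtype.val
  have inc_single : ∀ b : U, inc (Finsupp.single b 1) = Finsupp.single b.1 1 := fun b => by
    simp [inc]
  have res_of_mem : ∀ b (hb : b ∈ U), res (Finsupp.single b 1) = Finsupp.single ⟨b, hb⟩ 1 :=
    fun b hb => by
      ext x
      change Finsupp.single b (1 : R) x.1 = _
      simp [Finsupp.single_apply, Subtype.ext_iff]
  have res_of_notMem : ∀ b, b ∉ U → res (Finsupp.single b 1) = 0 := fun b hb => by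
    ext x
    change Finsupp.single b (1 : R) x.1 = 0
    exact Finsupp.single_eq_of_ne fun h => hb (h ▸ x.2)
  have key : ∀ {M : Type u} [AddCommGroup M] [Module R M] (f : (B →₀ R) →ₗ[R] M),
      (∀ b ∈ S, f (Finsupp.single b 1) = 0) → ∀ x : B →₀ R, (∀ b ∈ x.support, b ∈ S ∪ T) →
        f (inc (res x)) = f x := fun f hf x hx => by
    refine LinearMap.eq_of_forall_mem_support (f := f ∘ₗ inc ∘ₗ res) (g := f) fun b hb => ?_
    change f (inc (res _)) = _
    by_cases hbS : b ∈ S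
    · rw [res_of_notMem b fun h => h.2 hbS, map_zero, map_zero, hf b hbS]
    · rw [res_of_mem b ⟨(hx b hb).resolve_left hbS, hbS⟩, inc_single]
  have dinc : ∀ y, ∀ b ∈ (d (inc y)).support, b ∈ S ∪ T := fun y b hb => by
    by_contra hbT
    have h0 : Finsupp.lapply (R := R) b ∘ₗ d ∘ₗ inc = 0 :=
      Finsupp.lhom_ext' fun a => LinearMap.ext_ring (by
        change d (inc (Finsupp.single a 1)) b = 0
        rw [inc_single]
        by_contra h
        exact hbT (Or.inr (hT a a.2.1 b (Finsupp.mem_support_iff.2 h))))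
    exact Finsupp.mem_support_iff.1 hb (LinearMap.congr_fun h0 y)
  have resd : ∀ b ∈ S, res (d (Finsupp.single b 1)) = 0 := fun b hb =>
    LinearMap.eq_of_forall_mem_support (f := res) (g := 0) fun y hy =>
      res_of_notMem y fun h => h.2 (hS b hb y hy)
  let δ := DualNumber.differential R C
  let φ' : (B →₀ R) →ₗ[R] C := φ - (s ∘ₗ d + δ ∘ₗ s)
  have hφ'S : ∀ b ∈ S, φ' (Finsupp.single b 1) = 0 := fun b hb => sub_eq_zero.2 (hs b hb)
  have hφ'_apply : ∀ x, φ' x = φ x - (s (d x) + (ε : R[ε]) • s x) := fun x => rfl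
  have hφ' : ∀ x, φ' (d x) = (ε : R[ε]) • φ' x := fun x => by
    rw [hφ'_apply, hφ'_apply, hd, map_zero, zero_add, hφ, smul_sub, smul_add,
      DualNumber.eps_smul_eps_smul, add_zero]
  obtain ⟨t, ht⟩ := hC.exists_homotopy_of_countable (res ∘ₗ d ∘ₗ inc)
    (fun y => by
      change res (d (inc (res (d (inc y))))) = 0
      have := key (res ∘ₗ d) resd _ (dinc y)
      change res (d (inc (res (d (inc y))))) = res (d (d (inc y))) at this
      rw [this, hd, map_zero])
    (φ' ∘ₗ inc) (fun y => by
      change φ' (inc (res (d (inc y)))) = (ε : R[ε]) • φ' (inc y)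
      rw [key φ' hφ'S _ (dinc y), hφ'])
  refine ⟨s + t ∘ₗ res, fun b hb => ?_, fun b hb => ?_⟩
  · rw [LinearMap.add_apply, LinearMap.comp_apply, res_of_notMem b fun h => h.2 hb, map_zero,
      add_zero]
  · change _ = (s (d _) + t (res (d _))) + (ε : R[ε]) • (s _ + t (res _))
    by_cases hbS : b ∈ S
    · rw [resd b hbS, res_of_notMem b fun h => h.2 hbS, map_zero, add_zero, add_zero, hs b hbS]
    · have hbU : b ∈ U := ⟨hb.resolve_left hbS, hbS⟩
      have := ht (Finsupp.single ⟨b, hbU⟩ 1)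
      simp only [LinearMap.comp_apply, inc_single] at this
      rw [hφ'_apply, sub_eq_iff_eq_add] at this
      rw [this, res_of_mem b hbU, smul_add]
      abel

/-- Chain maps from a free differential module to a differential module that is flat over the dual
numbers are null-homotopic. -/
theorem EquationallyFlat.exists_homotopy_of_free (hC : EquationallyFlat R[ε] C)
    {B : Type u} (d : (B →₀ R) →ₗ[R] (B →₀ R)) (hd : ∀ x, d (d x) = 0)
    (φ : (B →₀ R) →ₗ[R] C) (hφ : ∀ x, φ (d x) = (ε : R[ε]) • φ x) :
    ∃ s : (B →₀ R) →ₗ[R] C, ∀ x, φ x = s (d x) + (ε : R[ε]) • s x := by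
  classical
  let X := {q : Set B × ((B →₀ R) →ₗ[R] C) //
    (∀ x ∈ q.1, ∀ y ∈ (d (Finsupp.single x 1)).support, y ∈ q.1) ∧
    ∀ b ∈ q.1, φ (Finsupp.single b 1) =
      q.2 (d (Finsupp.single b 1)) + (ε : R[ε]) • q.2 (Finsupp.single b 1)}
  -- A partial homotopy is a total map whose values matter only on the chosen basis elements, so `r`
  -- is a preorder and not antisymmetric.
  let r : X → X → Prop := fun q q' => q.1.1 ⊆ q'.1.1 ∧
    ∀ b ∈ q.1.1, q'.1.2 (Finsupp.single b 1) = q.1.2 (Finsupp.single b 1)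
  obtain ⟨m, hm⟩ := exists_maximal_of_chains_bounded (r := r) (fun c hc => by
    let V : Set B := {b | ∃ q ∈ c, b ∈ q.1.1}
    let g : B → C := fun b => if h : ∃ q ∈ c, b ∈ q.1.1 then
      h.choose.1.2 (Finsupp.single b 1) else 0
    let s : (B →₀ R) →ₗ[R] C := Finsupp.linearCombination R g
    have hs : ∀ q ∈ c, ∀ b ∈ q.1.1, s (Finsupp.single b 1) = q.1.2 (Finsupp.single b 1) := by
      intro q hq b hb
      have h : ∃ q ∈ c, b ∈ q.1.1 := ⟨q, hq, hb⟩
      have h1 : s (Finsupp.single b 1) = h.choose.1.2 (Finsupp.single b 1) := by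
        simp only [s, Finsupp.linearCombination_single, one_smul, g, dif_pos h]
      rw [h1]
      by_cases hqq : h.choose = q
      · rw [hqq]
      · rcases hc h.choose_spec.1 hq hqq with h2 | h2
        · exact (h2.2 b h.choose_spec.2).symm
        · exact h2.2 b hb
    refine ⟨⟨(V, s), ?_, ?_⟩, fun q hq => ⟨fun b hb => ⟨q, hq, hb⟩, hs q hq⟩⟩
    · rintro x ⟨q, hq, hx⟩ y hy
      exact ⟨q, hq, q.2.1 x hx y hy⟩
    · rintro b ⟨q, hq, hb⟩
      rw [q.2.2 b hb, hs q hq b hb]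
      congr 1
      exact (LinearMap.eq_of_forall_mem_support fun y hy => hs q hq y (q.2.1 b hb y hy)).symm)
    (fun {a b c} hab hbc => ⟨hab.1.trans hbc.1,
      fun x hx => (hbc.2 x (hab.1 hx)).trans (hab.2 x hx)⟩)
  have hall : ∀ b, b ∈ m.1.1 := fun b => by
    obtain ⟨T, hTc, hbT, hT⟩ := exists_countable_closed d b
    obtain ⟨s', hs', hs''⟩ := hC.exists_homotopy_extension d hd φ hφ m.1.1 T m.2.1 hT hTc m.1.2
      m.2.2
    refine (hm ⟨(m.1.1 ∪ T, s'), ?_, hs''⟩ ⟨Set.subset_union_left, hs'⟩).1 (Or.inr hbT)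
    rintro x (hx | hx) y hy
    · exact Or.inl (m.2.1 x hx y hy)
    · exact Or.inr (hT x hx y hy)
  refine ⟨m.1.2, fun x => ?_⟩
  have : φ = m.1.2 ∘ₗ d + DualNumber.differential R C ∘ₗ m.1.2 :=
    Finsupp.lhom_ext' fun b => LinearMap.ext_ring (m.2.2 b (hall b))
  exact LinearMap.congr_fun this x

/-- Chain maps from a projective differential module to a differential module that is flat over the
dual numbers are null-homotopic. -/
theorem EquationallyFlat.exists_homotopy (hC : EquationallyFlat R[ε] C)
    {A : Type u} [AddCommGroup A] [Module R A] (hA : Module.Projective R A)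
    (d : A →ₗ[R] A) (hd : ∀ x, d (d x) = 0)
    (φ : A →ₗ[R] C) (hφ : ∀ x, φ (d x) = (ε : R[ε]) • φ x) :
    ∃ s : A →ₗ[R] C, ∀ x, φ x = s (d x) + (ε : R[ε]) • s x := by
  obtain ⟨i, hi⟩ := hA.out
  let q : (A →₀ R) →ₗ[R] A := Finsupp.linearCombination R id
  have hqi : ∀ a, q (i a) = a := hi
  -- The differential of the retract `A` is transported to the free module; it squares to zero
  -- because q ∘ i = id.
  obtain ⟨s, hs⟩ := hC.exists_homotopy_of_free (i ∘ₗ d ∘ₗ q)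
    (fun x => by simp only [LinearMap.comp_apply, hqi, hd, map_zero]) (φ ∘ₗ q)
    (fun x => by simp only [LinearMap.comp_apply, hqi, hφ])
  refine ⟨s ∘ₗ i, fun x => ?_⟩
  have := hs (i x)
  simpa only [LinearMap.comp_apply, hqi] using this

end NullHomotopy

/-! ### Coresolutions by double character modules -/

section FlatCoresolution

variable {R : Type u} [Ring R]

/-- The canonical map of a left module into its double character module. -/
def CharacterModule.eval (X : Type u) [AddCommGroup X] [Module R X] :
    X →ₗ[R] CharacterModule (CharacterModule X) where
  toFun x := (AddMonoidHom.mk' (fun c : CharacterModule X => c x) fun _ _ => rfl :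
    CharacterModule X →+ AddCircle (1 : ℚ))
  map_add' x y := CharacterModule.ext _ fun c => map_add c x y
  map_smul' _ _ := CharacterModule.ext _ fun _ => rfl

theorem CharacterModule.eval_injective (X : Type u) [AddCommGroup X] [Module R X] :
    Function.Injective (eval (R := R) X) :=
  (injective_iff_map_eq_zero _).2 fun _ hx =>
    CharacterModule.eq_zero_of_character_apply fun c => DFunLike.congr_fun hx c

/-- The transpose of a linear map of left modules. -/
def CharacterModule.transpose {X Y : Type u} [AddCommGroup X] [Module R X] [AddCommGroup Y]
    [Module R Y] (f : X →ₗ[R] Y) : CharacterModule Y →ₗ[Rᵐᵒᵖ] CharacterModule X where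
  toFun c := AddMonoidHom.comp c f.toAddMonoidHom
  map_add' _ _ := CharacterModule.ext _ fun _ => rfl
  map_smul' r c := CharacterModule.ext _ fun x => congrArg c (map_smul f r.unop x).symm

/-- Over a right coherent ring the cokernel of a flat module in its double character module is
flat. -/
theorem EquationallyFlat.quotient_range_eval (hR : IsRightCoherent R) {X : Type u}
    [AddCommGroup X] [Module R X] (hX : EquationallyFlat R X) :
    EquationallyFlat R (CharacterModule (CharacterModule X) ⧸
      LinearMap.range (CharacterModule.eval (R := R) X)) := by
  -- The sequence 0 → (X⁺⁺/X)⁺ → X⁺⁺⁺ → X⁺ → 0 is split by evaluation X⁺ → X⁺⁺⁺, and X⁺⁺⁺ is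
  -- injective. An extension with values in X⁺⁺⁺ is projected to the summand (X⁺⁺/X)⁺ by subtracting
  -- w ↦ w (e n).
  have hX3 := (EquationallyFlat.of_isRightCoherent hR hX.injective).injective
  refine EquationallyFlat.of_injective ⟨fun N N' _ _ _ _ i hi g => ?_⟩
  let π := (LinearMap.range (CharacterModule.eval (R := R) X)).mkQ
  obtain ⟨h, hh⟩ := hX3.out i hi (CharacterModule.transpose π ∘ₗ g)
  let e : N' →ₗ[Rᵐᵒᵖ] CharacterModule X :=
    CharacterModule.transpose (CharacterModule.eval (R := R) X) ∘ₗ h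
  let k : N' → CharacterModule (CharacterModule X) →+ AddCircle (1 : ℚ) := fun n =>
    AddMonoidHom.mk' (fun w => h n w - w (e n)) fun w w' => by
      rw [map_add]
      exact add_sub_add_comm _ _ _ _
  have mem : ∀ n w, w ∈ (LinearMap.range (CharacterModule.eval (R := R) X)).toAddSubgroup →
      k n w = 0 := by
    rintro n _ ⟨x, rfl⟩
    exact sub_self _
  let h' : N' →ₗ[Rᵐᵒᵖ] CharacterModule (CharacterModule (CharacterModule X) ⧸
      LinearMap.range (CharacterModule.eval (R := R) X)) :=
    { toFun := fun n => QuotientAddGroup.lift _ (k n) (mem n)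
      map_add' := fun a b => CharacterModule.ext _ fun y => by
        obtain ⟨w, rfl⟩ := Submodule.Quotient.mk_surjective _ y
        change h (a + b) w - w (e (a + b)) = (h a w - w (e a)) + (h b w - w (e b))
        rw [map_add, map_add, map_add]
        exact add_sub_add_comm _ _ _ _
      map_smul' := fun r a => CharacterModule.ext _ fun y => by
        obtain ⟨w, rfl⟩ := Submodule.Quotient.mk_surjective _ y
        change h (r • a) w - w (e (r • a)) = h a (r.unop • w) - w (r • e a)
        rw [map_smul, map_smul]
        rfl }
  refine ⟨h', fun n => CharacterModule.ext _ fun y => ?_⟩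
  obtain ⟨w, rfl⟩ := Submodule.Quotient.mk_surjective _ y
  change h (i n) w - w (e (i n)) = g n (π w)
  have he : e (i n) = 0 := by
    refine CharacterModule.ext _ fun x => ?_
    change h (i n) (CharacterModule.eval (R := R) X x) = 0
    have hx : π (CharacterModule.eval (R := R) X x) = 0 :=
      (Submodule.Quotient.mk_eq_zero _).2 ⟨x, rfl⟩
    rw [hh]
    change g n (π _) = 0
    rw [hx, map_zero]
  rw [he, hh, map_zero, sub_zero]
  rfl

variable (R) in
/-- The cosyzygies of a module in its coresolution by double character modules. -/
noncomputable def characterCosyzygy (X : Type u) [AddCommGroup X] [Module R X] :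
    ℕ → ModuleCat.{u} R
  | 0 => ModuleCat.of R X
  | n + 1 => ModuleCat.of R (CharacterModule (CharacterModule (characterCosyzygy X n)) ⧸
      LinearMap.range (CharacterModule.eval (R := R) (characterCosyzygy X n)))

theorem EquationallyFlat.characterCosyzygy (hR : IsRightCoherent R) {X : Type u} [AddCommGroup X]
    [Module R X] (hX : EquationallyFlat R X) (n : ℕ) :
    EquationallyFlat R (characterCosyzygy R X n) := by
  induction n with
  | zero => exact hX
  | succ n ih => exact ih.quotient_range_eval hR

end FlatCoresolution

/-! ### From character modules of injectives to all flat modules -/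

section HomExactness

variable {R : Type u} [Ring R] {A : Type u} [AddCommGroup A] [Module R A]

/-- `Hom_R(A, X)` is an exact differential group, for a differential module `A`. -/
def IsHomExact (d : A →ₗ[R] A) (X : Type u) [AddCommGroup X] [Module R X] : Prop :=
  ∀ g : A →ₗ[R] X, (∀ x, g (d x) = 0) → ∃ h : A →ₗ[R] X, ∀ x, g x = h (d x)

/-- Chain maps from a projective differential module to an extension of a flat module by itself
are null-homotopic. -/
theorem EquationallyFlat.exists_homotopy_of_selfExtension {C D : Type u} [AddCommGroup C]
    [Module R C] [AddCommGroup D] [Module R D] (hD : EquationallyFlat R D)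
    (ι : D →ₗ[R] C) (κ : C →ₗ[R] D) (hι : Function.Injective ι) (hκ : Function.Surjective κ)
    (hικ : Function.Exact ι κ) (hA : Module.Projective R A) (d : A →ₗ[R] A)
    (hd : ∀ x, d (d x) = 0) (φ : A →ₗ[R] C) (hφ : ∀ x, φ (d x) = ι (κ (φ x))) :
    ∃ s : A →ₗ[R] C, ∀ x, φ x = s (d x) + ι (κ (s x)) := by
  -- For the differential ι ∘ κ both the cycles and the boundaries are the image of `D`.
  let : Module R[ε] C := DualNumber.moduleOfDifferential (ι ∘ₗ κ) fun c => by
    simp only [LinearMap.comp_apply, hικ.apply_apply_eq_zero, map_zero]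
  have smul_def : ∀ (a : R[ε]) (c : C), a • c = a.fst • c + a.snd • ι (κ c) := fun _ _ => rfl
  have eps_smul : ∀ c : C, (ε : R[ε]) • c = ι (κ c) := fun c => by
    rw [smul_def]
    simp
  have : IsScalarTower R R[ε] C := ⟨fun r a c => by
    rw [smul_def, smul_def]
    simp [mul_smul]⟩
  have mem : ∀ x, ι x ∈ LinearMap.ker (DualNumber.differential R C) := fun x => by
    rw [LinearMap.mem_ker, DualNumber.differential_apply, eps_smul, hικ.apply_apply_eq_zero,
      map_zero]
  have eq_of_mem : ∀ c : C, (ε : R[ε]) • c = 0 → ∃ x, ι x = c := fun c hc => by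
    rw [eps_smul] at hc
    exact (hικ c).1 (hι (hc.trans (map_zero ι).symm))
  have hC : EquationallyFlat R[ε] C := by
    refine EquationallyFlat.dualNumber (fun c hc => ?_) fun α _ r x hx => ?_
    · obtain ⟨x, rfl⟩ := eq_of_mem c hc
      obtain ⟨c', rfl⟩ := hκ x
      exact ⟨c', (eps_smul c').symm⟩
    · choose x' hx' using fun i => eq_of_mem (x i).1 (x i).2
      obtain ⟨β, _, y, z, hz, hy⟩ := hD α r x' (by
        apply hι
        have := congrArg Subtype.val hx
        simpa [← hx'] using this)
      refine ⟨β, inferInstance, y, fun j => ⟨ι (z j), mem _⟩, fun i => ?_, hy⟩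
      apply Subtype.ext
      rw [← hx', hz]
      simp
  obtain ⟨s, hs⟩ := hC.exists_homotopy hA d hd φ fun x => by rw [hφ, eps_smul]
  exact ⟨s, fun x => by rw [hs, eps_smul]⟩

/-- `Hom_R(A, -)` exactness passes to the start of an infinite coresolution with flat cycles. -/
theorem IsHomExact.of_coresolution (hR : IsRightCoherent R) {F G : ℕ → Type u}
    [∀ n, AddCommGroup (F n)] [∀ n, Module R (F n)] [∀ n, AddCommGroup (G n)]
    [∀ n, Module R (G n)] (hF : ∀ n, EquationallyFlat R (F n))
    (ι : ∀ n, F n →ₗ[R] G n) (π : ∀ n, G n →ₗ[R] F (n + 1))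
    (hι : ∀ n, Function.Injective (ι n)) (hπ : ∀ n, Function.Surjective (π n))
    (hιπ : ∀ n, Function.Exact (ι n) (π n))
    (hA : Module.Projective R A) (d : A →ₗ[R] A) (hd : ∀ x, d (d x) = 0)
    (hG : ∀ n, IsHomExact d (G n)) : IsHomExact d (F 0) := by
  intro g hg
  have step : ∀ n (θ : {θ : A →ₗ[R] F n // ∀ x, θ (d x) = 0}),
      ∃ φ : A →ₗ[R] G n, ∀ x, ι n (θ.1 x) = φ (d x) := fun n θ =>
    hG n (ι n ∘ₗ θ.1) fun x => by rw [LinearMap.comp_apply, θ.2, map_zero]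
  choose ext hext using step
  let θ : ∀ n, {θ : A →ₗ[R] F n // ∀ x, θ (d x) = 0} := fun n => Nat.rec ⟨g, hg⟩
    (fun n θ => ⟨π n ∘ₗ ext n θ, fun x => by
      rw [LinearMap.comp_apply, ← hext, (hιπ n).apply_apply_eq_zero]⟩) n
  -- I ∘ K is the differential of the augmented coresolution F 0 → G 0 → G 1 → ⋯, folded into one
  -- module whose cycles are ∏ F n.
  let I : (∀ n, F n) →ₗ[R] (F 0 × ∀ n, G n) :=
    LinearMap.prod 0 (LinearMap.pi fun n => ι n ∘ₗ LinearMap.proj n)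
  let K : (F 0 × ∀ n, G n) →ₗ[R] (∀ n, F n) := LinearMap.pi fun n =>
    match n with
    | 0 => LinearMap.fst R _ _
    | n + 1 => π n ∘ₗ LinearMap.proj n ∘ₗ LinearMap.snd R _ _
  let φ : A →ₗ[R] (F 0 × ∀ n, G n) := LinearMap.prod g (LinearMap.pi fun n => ext n (θ n))
  obtain ⟨s, hs⟩ := (EquationallyFlat.pi hR hF).exists_homotopy_of_selfExtension I K
    (fun _ _ hxy => funext fun n => hι n (congrFun (congrArg Prod.snd hxy) n))
    (fun y => by
      choose w hw using fun n => hπ n (y (n + 1))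
      refine ⟨(y 0, w), funext fun n => ?_⟩
      cases n with
      | zero => rfl
      | succ n => exact hw n)
    (fun c => by
      constructor
      · intro hc
        choose y hy using fun n => (hιπ n (c.2 n)).1 (congrFun hc (n + 1))
        exact ⟨y, Prod.ext (congrFun hc 0).symm (funext hy)⟩
      · rintro ⟨y, rfl⟩
        funext n
        cases n with
        | zero => rfl
        | succ n => exact (hιπ n).apply_apply_eq_zero (y n))
    hA d hd φ (fun x => by
      refine Prod.ext (hg x) (funext fun n => ?_)
      change ext n (θ n) (d x) = ι n (K (φ x) n)
      rw [← hext]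
      cases n with
      | zero => rfl
      | succ n => rfl)
  -- The image of `I` has zero component in F 0, so there the homotopy reads g = s ∘ d.
  refine ⟨LinearMap.fst R _ _ ∘ₗ s, fun x => ?_⟩
  exact (congrArg Prod.fst (hs x)).trans (add_zero _)

/-- Over a right coherent ring, if `Hom_R(A, -)` is exact on character modules of injective right
modules, then it is exact on flat modules. -/
theorem IsHomExact.of_equationallyFlat (hR : IsRightCoherent R) (hA : Module.Projective R A)
    (d : A →ₗ[R] A) (hd : ∀ x, d (d x) = 0)
    (h : ∀ (I : Type u) [AddCommGroup I] [Module Rᵐᵒᵖ I], Module.Injective Rᵐᵒᵖ I →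
      IsHomExact d (CharacterModule I))
    {X : Type u} [AddCommGroup X] [Module R X] (hX : EquationallyFlat R X) : IsHomExact d X := by
  exact IsHomExact.of_coresolution (F := fun n => characterCosyzygy R X n)
    (G := fun n => CharacterModule (CharacterModule (characterCosyzygy R X n))) hR
    (hX.characterCosyzygy hR)
    (fun n => CharacterModule.eval (characterCosyzygy R X n))
    (fun n => (LinearMap.range (CharacterModule.eval (R := R) (characterCosyzygy R X n))).mkQ)
    (fun n => CharacterModule.eval_injective (characterCosyzygy R X n))
    (fun _ => Submodule.mkQ_surjective _)
    (fun _ => LinearMap.exact_map_mkQ_range _) hA d hd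
    (fun n => h _ (hX.characterCosyzygy hR n).injective)

/-- An exact complex of projective modules has the same `Hom` exactness properties as a projective
differential module, the direct sum of its terms. -/
theorem ExactProjectiveComplex.exists_differential (P : ExactProjectiveComplex R) :
    ∃ (A : Type u) (_ : AddCommGroup A) (_ : Module R A) (d : A →ₗ[R] A),
      Module.Projective R A ∧ (∀ x, d (d x) = 0) ∧
        ∀ X : ModuleCat.{u} R, P.HomExact X ↔ IsHomExact d X := by
  let A := DirectSum ℤ fun i => P.X i
  let of : ∀ i, P.X i →ₗ[R] A := DirectSum.lof R ℤ fun i => P.X i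
  -- The differentials start at indices of the form i + 1, whereas the universal property of the
  -- direct sum needs a map for every j.
  have exD : ∀ j, ∃ D : P.X j →ₗ[R] A, ∀ i (h : j = i + 1) (x : P.X (i + 1)),
      D (h ▸ x) = of i (P.d i x) := fun j => by
    obtain ⟨i, rfl⟩ : ∃ i, j = i + 1 := ⟨j - 1, by ring⟩
    refine ⟨of i ∘ₗ P.d i, fun k h x => ?_⟩
    obtain rfl : i = k := by omega
    rfl
  choose D hD using exD
  let d : A →ₗ[R] A := DirectSum.toModule R ℤ A D
  have d_of : ∀ i (x : P.X (i + 1)), d (of (i + 1) x) = of i (P.d i x) := fun i x =>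
    (DirectSum.toModule_lof R (φ := D) (i + 1) x).trans (hD (i + 1) i rfl x)
  have hom_ext : ∀ {Y : Type u} [AddCommGroup Y] [Module R Y] {f g : A →ₗ[R] Y},
      (∀ i (x : P.X (i + 1)), f (of (i + 1) x) = g (of (i + 1) x)) → f = g := fun h =>
    DirectSum.linearMap_ext R fun j => by
      obtain ⟨i, rfl⟩ : ∃ i, j = i + 1 := ⟨j - 1, by ring⟩
      exact LinearMap.ext (h i)
  have proj : Module.Projective R A := by
    have := P.projective
    infer_instance
  refine ⟨A, inferInstance, inferInstance, d, proj, fun x => ?_, fun X => ⟨fun h g hg => ?_,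
    fun h i f => ⟨fun hf => ?_, ?_⟩⟩⟩
  · have : d ∘ₗ d = 0 := hom_ext fun i x => by
      obtain ⟨k, rfl⟩ : ∃ k, i = k + 1 := ⟨i - 1, by ring⟩
      rw [LinearMap.comp_apply, d_of, d_of, (P.exact k).apply_apply_eq_zero, map_zero]
      rfl
    exact LinearMap.congr_fun this x
  · have : ∀ i, ∃ k : P.X i →ₗ[R] X, ∀ x, k (P.d i x) = g (of (i + 1) x) := fun i => by
      obtain ⟨k, hk⟩ := (h i (g ∘ₗ of (i + 1))).1 (LinearMap.ext fun x => by
        rw [LinearMap.comp_apply, LinearMap.comp_apply, ← d_of, hg]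
        rfl)
      exact ⟨k, fun x => LinearMap.congr_fun hk x⟩
    choose k hk using this
    let k' : A →ₗ[R] X := DirectSum.toModule R ℤ X k
    have : g = k' ∘ₗ d := hom_ext fun i x => by
      rw [LinearMap.comp_apply, d_of, ← hk]
      exact (DirectSum.toModule_lof R (φ := k) i _).symm
    exact ⟨k', LinearMap.congr_fun this⟩
  -- A cocycle in a single degree is extended by zero to the direct sum.
  · let pr : A →ₗ[R] P.X (i + 1) := DirectSum.component R ℤ (fun i => P.X i) (i + 1)
    have pr_of : ∀ x, pr (of (i + 1) x) = x := fun x =>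
      DirectSum.component.lof_self R (M := fun i => P.X i) (i + 1) x
    have pr_of_ne : ∀ j (x : P.X j), j ≠ i + 1 → pr (of j x) = 0 := fun j x hj =>
      (DirectSum.component.of R (M := fun i => P.X i) (i + 1) j x).trans (dif_neg hj)
    obtain ⟨k, hk⟩ := h (f ∘ₗ pr) (fun x => by
      have : (f ∘ₗ pr) ∘ₗ d = 0 := hom_ext fun j x => by
        rw [LinearMap.comp_apply, d_of, LinearMap.comp_apply]
        by_cases hj : j = i + 1
        · subst hj
          rw [pr_of]
          exact LinearMap.congr_fun hf x
        · rw [pr_of_ne _ _ hj, map_zero, LinearMap.zero_apply]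
      exact LinearMap.congr_fun this x)
    refine ⟨k ∘ₗ of i, LinearMap.ext fun x => ?_⟩
    have := hk (of (i + 1) x)
    rw [LinearMap.comp_apply, pr_of, d_of] at this
    exact this.symm
  · rintro ⟨k, rfl⟩
    refine LinearMap.ext fun x => ?_
    change k (P.d i (P.d (i + 1) x)) = 0
    rw [(P.exact i).apply_apply_eq_zero, map_zero]

end HomExactness

/-! ### Ext¹ of cycles and Hom exactness -/

section Ext

variable {R : Type u} [Ring R]

/-- Vanishing of `Ext¹` in terms of a projective presentation. -/
theorem subsingleton_ext_one_iff {K Q N F : ModuleCat.{u} R} (f : K →ₗ[R] Q) (g : Q →ₗ[R] N)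
    (hf : Function.Injective f) (hg : Function.Surjective g) (hfg : Function.Exact f g)
    (hQ : Module.Projective R Q) :
    Subsingleton (Abelian.Ext N F 1) ↔ ∀ h : K →ₗ[R] F, ∃ h' : Q →ₗ[R] F, ∀ x, h' (f x) = h x := by
  have hS : (ShortComplex.mk (ModuleCat.ofHom f) (ModuleCat.ofHom g)
      (by ext x; exact hfg.apply_apply_eq_zero x)).ShortExact :=
    { exact := (ShortComplex.ShortExact.moduleCat_exact_iff_function_exact _).2 hfg
      mono_f := (ModuleCat.mono_iff_injective _).2 hf
      epi_g := (ModuleCat.epi_iff_surjective _).2 hg }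
  have : Projective Q := (IsProjective.iff_projective (R := R) Q).1 hQ
  constructor
  · intro _ h
    obtain ⟨x, hx⟩ := Abelian.Ext.contravariant_sequence_exact₁ hS F
      (Abelian.Ext.mk₀ (ModuleCat.ofHom h)) (add_zero 1) (Subsingleton.elim _ _)
    obtain ⟨h', rfl⟩ := Abelian.Ext.homEquiv₀.symm.surjective x
    rw [Abelian.Ext.homEquiv₀_symm_apply, Abelian.Ext.mk₀_comp_mk₀] at hx
    have := Abelian.Ext.homEquiv₀.symm.injective hx
    exact ⟨h'.hom, fun x => LinearMap.congr_fun (congrArg ModuleCat.Hom.hom this) x⟩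
  · intro H
    refine subsingleton_of_forall_eq 0 fun e => ?_
    obtain ⟨x, rfl⟩ := Abelian.Ext.contravariant_sequence_exact₃ hS F e
      (Abelian.Ext.eq_zero_of_projective _) (add_zero 1)
    obtain ⟨h, rfl⟩ := Abelian.Ext.homEquiv₀.symm.surjective x
    obtain ⟨h', hh'⟩ := H h.hom
    have : h = ModuleCat.ofHom f ≫ ModuleCat.ofHom h' := by
      ext x
      exact (hh' x).symm
    rw [Abelian.Ext.homEquiv₀_symm_apply, this, ← Abelian.Ext.mk₀_comp_mk₀]
    exact hS.extClass_comp_assoc _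

namespace ExactProjectiveComplex

variable (P : ExactProjectiveComplex R)

/-- The differential of an exact complex, with the module of cycles as codomain. -/
def toCycles (i : ℤ) : P.X (i + 1 + 1) →ₗ[R] LinearMap.ker (P.d i) :=
  (P.d (i + 1)).codRestrict _ fun x => (P.exact i).apply_apply_eq_zero x

theorem toCycles_surjective (i : ℤ) : Function.Surjective (P.toCycles i) := fun y => by
  obtain ⟨x, hx⟩ := (P.exact i y.1).1 y.2
  exact ⟨x, Subtype.ext hx⟩

theorem toCycles_eq_zero_iff (i : ℤ) (x : P.X (i + 1 + 1)) :
    P.toCycles i x = 0 ↔ P.d (i + 1) x = 0 := Subtype.ext_iff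

/-- Hom exactness of an exact complex in terms of extending maps from cycles. -/
theorem homExact_iff (F : ModuleCat.{u} R) :
    P.HomExact F ↔ ∀ i (h : LinearMap.ker (P.d (i + 1)) →ₗ[R] F),
      ∃ h' : P.X (i + 1 + 1) →ₗ[R] F, ∀ x, h' x.1 = h x := by
  constructor
  · intro H i h
    obtain ⟨h', hh'⟩ := (H (i + 1 + 1) (h ∘ₗ P.toCycles (i + 1))).1 (LinearMap.ext fun x => by
      have : P.toCycles (i + 1) (P.d (i + 1 + 1 + 1) x) = 0 :=
        (P.toCycles_eq_zero_iff _ _).2 ((P.exact (i + 1 + 1)).apply_apply_eq_zero x)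
      rw [LinearMap.comp_apply, LinearMap.comp_apply, this, map_zero, LinearMap.zero_apply])
    refine ⟨h', fun x => ?_⟩
    obtain ⟨y, rfl⟩ := P.toCycles_surjective (i + 1) x
    exact LinearMap.congr_fun hh' y
  · intro H i f
    constructor
    · intro hf
      -- A cocycle `f` on X (k + 3) descends to the cycles ker (d (k + 1)), from which it is
      -- extended to X (k + 2).
      obtain ⟨k, rfl⟩ : ∃ k, i = k + 1 + 1 := ⟨i - 1 - 1, by ring⟩
      choose y hy using P.toCycles_surjective (k + 1)
      have key : ∀ x x', P.toCycles (k + 1) x = P.toCycles (k + 1) x' → f x = f x' := by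
        intro x x' hx
        rw [← sub_eq_zero, ← map_sub, P.toCycles_eq_zero_iff] at hx
        obtain ⟨z, hz⟩ := (P.exact (k + 1 + 1) _).1 hx
        rw [← sub_eq_zero, ← map_sub, ← hz]
        exact LinearMap.congr_fun hf z
      let h : LinearMap.ker (P.d (k + 1)) →ₗ[R] F :=
        { toFun := fun x => f (y x)
          map_add' := fun a b => by
            rw [← map_add]
            exact key _ _ (by rw [map_add, hy, hy, hy])
          map_smul' := fun r a => by
            rw [RingHom.id_apply, ← map_smul]
            exact key _ _ (by rw [map_smul, hy, hy]) }
      obtain ⟨h', hh'⟩ := H k h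
      exact ⟨h', LinearMap.ext fun x => (hh' (P.toCycles (k + 1) x)).trans (key _ _ (hy _))⟩
    · rintro ⟨k, rfl⟩
      refine LinearMap.ext fun x => ?_
      change k (P.d i (P.d (i + 1) x)) = 0
      rw [(P.exact i).apply_apply_eq_zero, map_zero]

/-- The presentation used is 0 → ker (d (i + 1)) → X (i + 2) → ker (d i) → 0. -/
theorem subsingleton_ext_iff {M F : ModuleCat.{u} R} {i : ℤ} (e : M ≃ₗ[R] LinearMap.ker (P.d i)) :
    Subsingleton (Abelian.Ext M F 1) ↔ ∀ h : LinearMap.ker (P.d (i + 1)) →ₗ[R] F,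
      ∃ h' : P.X (i + 1 + 1) →ₗ[R] F, ∀ x, h' x.1 = h x :=
  subsingleton_ext_one_iff (K := ModuleCat.of R (LinearMap.ker (P.d (i + 1))))
    (LinearMap.ker (P.d (i + 1))).subtype (e.symm.toLinearMap ∘ₗ P.toCycles i)
    (Submodule.subtype_injective _)
    (e.symm.surjective.comp (P.toCycles_surjective i))
    (fun x => by
      rw [LinearMap.comp_apply, LinearEquiv.coe_coe, LinearEquiv.map_eq_zero_iff,
        P.toCycles_eq_zero_iff, Submodule.coe_subtype, Subtype.range_coe]
      rfl)
    (P.projective _)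

theorem HomExact.subsingleton_ext {P : ExactProjectiveComplex R} {M F : ModuleCat.{u} R}
    (h : P.HomExact F) (hM : P.IsCycle M) : Subsingleton (Abelian.Ext M F 1) := by
  obtain ⟨i, ⟨e⟩⟩ := hM
  exact (P.subsingleton_ext_iff e).2 ((P.homExact_iff F).1 h i)

theorem homExact_of_subsingleton_ext {F : ModuleCat.{u} R}
    (h : ∀ M : ModuleCat.{u} R, P.IsCycle M → Subsingleton (Abelian.Ext M F 1)) : P.HomExact F :=
  (P.homExact_iff F).2 fun i => (P.subsingleton_ext_iff (M := ModuleCat.of R _)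
    (LinearEquiv.refl R (LinearMap.ker (P.d i)))).1 (h _ ⟨i, ⟨LinearEquiv.refl R _⟩⟩)

/-- Hom exactness passes to cokernels of injective maps. -/
theorem HomExact.of_shortExact {P : ExactProjectiveComplex R} {F₁ F₂ F₃ : ModuleCat.{u} R}
    (f : F₁ →ₗ[R] F₂) (g : F₂ →ₗ[R] F₃) (hf : Function.Injective f)
    (hg : Function.Surjective g) (hfg : Function.Exact f g)
    (h₁ : P.HomExact F₁) (h₂ : P.HomExact F₂) : P.HomExact F₃ := by
  intro i k
  constructor
  · intro hk
    have := P.projective (i + 1)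
    -- The lift `l` of the cocycle `k` need not be a cocycle, but its coboundary is a cocycle with
    -- values in F₁, hence of the form n ∘ d; then l - f ∘ n is a cocycle in F₂.
    obtain ⟨l, hl⟩ := Module.projective_lifting_property g k hg
    have hl' : ∀ x, l (P.d (i + 1) x) ∈ LinearMap.range f := fun x =>
      (hfg _).1 ((LinearMap.congr_fun hl _).trans (LinearMap.congr_fun hk x))
    let m : P.X (i + 1 + 1) →ₗ[R] F₁ := (LinearEquiv.ofInjective f hf).symm.toLinearMap ∘ₗ
      (l ∘ₗ P.d (i + 1)).codRestrict _ hl'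
    have hm : ∀ x, f (m x) = l (P.d (i + 1) x) := fun x =>
      congrArg Subtype.val ((LinearEquiv.ofInjective f hf).apply_symm_apply ⟨_, hl' x⟩)
    obtain ⟨n, hn⟩ := (h₁ (i + 1) m).1 (LinearMap.ext fun x => hf (by
      rw [LinearMap.comp_apply, hm, (P.exact (i + 1)).apply_apply_eq_zero, map_zero,
        LinearMap.zero_apply, map_zero]))
    obtain ⟨p, hp⟩ := (h₂ i (l - f ∘ₗ n)).1 (LinearMap.ext fun x => by
      have := LinearMap.congr_fun hn x
      change l (P.d (i + 1) x) - f (n (P.d (i + 1) x)) = 0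
      rw [← hm, ← this]
      exact sub_self _)
    refine ⟨g ∘ₗ p, LinearMap.ext fun x => ?_⟩
    have := LinearMap.congr_fun hp x
    change g (p (P.d i x)) = k x
    change p (P.d i x) = l x - f (n x) at this
    rw [this, map_sub, hfg.apply_apply_eq_zero, sub_zero]
    exact LinearMap.congr_fun hl x
  · rintro ⟨l, rfl⟩
    refine LinearMap.ext fun x => ?_
    change l (P.d i (P.d (i + 1) x)) = 0
    rw [(P.exact i).apply_apply_eq_zero, map_zero]

/-- A totally acyclic complex stays exact under `Hom` into modules of finite projective
dimension. -/
theorem homExact_of_hasProjectiveDimensionLE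
    (hP : ∀ Q : ModuleCat.{u} R, Module.Projective R Q → P.HomExact Q) (n : ℕ)
    (F : ModuleCat.{u} R) (hF : HasProjectiveDimensionLE F n) : P.HomExact F := by
  induction n generalizing F with
  | zero =>
    exact hP F ((IsProjective.iff_projective (R := R) F).2
      ((projective_iff_hasProjectiveDimensionLE_zero F).2 hF))
  | succ n ih =>
    let g : (F →₀ R) →ₗ[R] F := Finsupp.linearCombination R id
    have hg : Function.Surjective g := Finsupp.linearCombination_id_surjective R F
    let Q : ModuleCat.{u} R := ModuleCat.of R (F →₀ R)
    let K : ModuleCat.{u} R := ModuleCat.of R (LinearMap.ker g)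
    let f : K →ₗ[R] Q := (LinearMap.ker g).subtype
    have hfg : Function.Exact f g := LinearMap.exact_subtype_ker_map g
    have hS : (ShortComplex.mk (X₁ := K) (X₂ := Q) (X₃ := F) (ModuleCat.ofHom f)
        (ModuleCat.ofHom g) (by ext x; exact hfg.apply_apply_eq_zero x)).ShortExact :=
      { exact := (ShortComplex.ShortExact.moduleCat_exact_iff_function_exact _).2 hfg
        mono_f := (ModuleCat.mono_iff_injective _).2 (Submodule.subtype_injective _)
        epi_g := (ModuleCat.epi_iff_surjective _).2 hg }
    have hQ : Module.Projective R Q := inferInstanceAs (Module.Projective R (F →₀ R))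
    have : Projective Q := (IsProjective.iff_projective (R := R) Q).1 hQ
    have hK : HasProjectiveDimensionLE K n := hS.hasProjectiveDimensionLT_X₁ (n + 1)
      (hasProjectiveDimensionLT_of_ge Q 1 (n + 1) (by omega)) hF
    exact HomExact.of_shortExact f g (Submodule.subtype_injective _) hg hfg (ih K hK) (hP Q hQ)

/-- Over a right coherent ring, an exact complex of projective modules that stays exact under
tensoring with injective modules stays exact under `Hom` into flat modules. -/
theorem homExact_of_tensorExact (hR : IsRightCoherent R)
    (hP : ∀ (I : Type u) [AddCommGroup I] [Module Rᵐᵒᵖ I], Module.Injective Rᵐᵒᵖ I →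
      P.TensorExact I) (F : ModuleCat.{u} R) (hF : flatModules R F) : P.HomExact F := by
  obtain ⟨A, _, _, d, hA, hd, h⟩ := P.exists_differential
  refine (h F).2 (IsHomExact.of_equationallyFlat hR hA d hd (fun I _ _ hI => ?_)
    ((flatModules_iff_equationallyFlat F).1 hF))
  exact (h (ModuleCat.of R (CharacterModule I))).1 ((P.tensorExact_iff I).1 (hP I hI))

end ExactProjectiveComplex

/-! ### Comparison of the two classes -/

theorem flatModules_of_projective (Q : ModuleCat.{u} R) (hQ : Module.Projective R Q) :
    flatModules R Q :=
  (flatModules_iff_equationallyFlat Q).2 (EquationallyFlat.of_projective hQ)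

/-- Over a right coherent ring projectively coresolved Gorenstein flat modules are Gorenstein
projective. -/
theorem projectivelyCoresolvedGorensteinFlat_le (hR : IsRightCoherent R) :
    projectivelyCoresolvedGorensteinFlat R ≤ gorensteinProjective R := by
  rintro M ⟨P, hP, hM⟩
  exact ⟨P, fun Q hQ => P.homExact_of_tensorExact hR hP Q (flatModules_of_projective Q hQ), hM⟩

theorem gorensteinProjective_eq_of_flatModules_le (hR : IsRightCoherent R)
    (h : flatModules R ≤ extRightOrthogonal (gorensteinProjective R)) :
    gorensteinProjective R = projectivelyCoresolvedGorensteinFlat R := by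
  refine le_antisymm ?_ (projectivelyCoresolvedGorensteinFlat_le hR)
  rintro M ⟨P, hP, hM⟩
  refine ⟨P, fun I _ _ hI => (P.tensorExact_iff I).2 ?_, hM⟩
  -- Every cycle of `P`, not only `M`, is Gorenstein projective, with `P` itself as witness.
  exact P.homExact_of_subsingleton_ext fun N hN => h _
    ((flatModules_iff_equationallyFlat _).2 (EquationallyFlat.of_isRightCoherent hR hI)) N
    ⟨P, hP, hN⟩

theorem flatModules_le_of_gorensteinProjective_eq (hR : IsRightCoherent R)
    (h : gorensteinProjective R = projectivelyCoresolvedGorensteinFlat R) :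
    flatModules R ≤ extRightOrthogonal (gorensteinProjective R) := by
  rintro F hF M hM
  rw [h] at hM
  obtain ⟨P, hP, hM⟩ := hM
  exact (P.homExact_of_tensorExact hR hP F hF).subsingleton_ext hM

theorem flatModules_le_of_isLeftPerfectOfDim {n : ℕ} (hn : IsLeftPerfectOfDim R n) :
    flatModules R ≤ extRightOrthogonal (gorensteinProjective R) := by
  rintro F hF M ⟨P, hP, hM⟩
  exact (P.homExact_of_hasProjectiveDimensionLE hP n F (hn F hF)).subsingleton_ext hM

end Ext

theorem theorem4 (R : Type u) [Ring R] (hR : IsRightCoherent R) :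
    (gorensteinProjective R = projectivelyCoresolvedGorensteinFlat R ↔
      flatModules R ≤ extRightOrthogonal (gorensteinProjective R)) ∧
    (∀ n : ℕ, IsLeftPerfectOfDim R n →
      gorensteinProjective R = projectivelyCoresolvedGorensteinFlat R ∧
      flatModules R ≤ extRightOrthogonal (gorensteinProjective R)) :=
  ⟨⟨flatModules_le_of_gorensteinProjective_eq hR, gorensteinProjective_eq_of_flatModules_le hR⟩,
    fun _ hn => ⟨gorensteinProjective_eq_of_flatModules_le hR
      (flatModules_le_of_isLeftPerfectOfDim hn), flatModules_le_of_isLeftPerfectOfDim hn⟩⟩
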